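/- Let $d\ge 1$, let $\mathbb B_k$ be the open unit ball of $\mathbb C^k$, and let $H^2_d$ be the Drury–Arveson space: the completion of $\mathbb C[z_1,\dots,z_d]$ for $\langle z^\alpha,z^\beta\rangle=\delta_{\alpha\beta}\,\alpha!/|\alpha|!$, a Hilbert space of holomorphic functions on $\mathbb B_d$ on which multiplication by $z_j$ is a bounded operator $M_{z_j}$. For $(\lambda,\mu)\in\mathbb B_d$ with $\lambda\in\mathbb C^{d-1}$, $\mu\in\mathbb C$, and $\ell\ge 0$, let $k^{(\ell)}_{(\lambda,\mu)}\in H^2_d$ be the vector with $\langle f,k^{(\ell)}_{(\lambda,\mu)}\rangle=\frac{\partial^\ell f}{\partial z_d^\ell}(\lambda,\mu)$ for all $f\in H^2_d$. For a domain $\Omega\subset\mathbb C^{m}$, a commuting tuple $T=(T_1,\dots,T_m)$ of bounded operators on a Hilbert space $\mathcal H$ is in the Cowen–Douglas class $B_n(\Omega)$ if for every $\omega\in\Omega$ the operator $\mathcal H\to\mathcal H\otimes\mathbb C^m$, $h\mapsto((T_j-\omega_j)h)_j$, has closed range, its kernel $\bigcap_j\ker(T_j-\omega_j)$ has dimension $n$,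 and these kernels for $\omega\in\Omega$ together span a dense subspace of $\mathcal H$. Let $p\in\mathbb C[z_1,\dots,z_d]$ be homogeneous of degree $n$ with $p(0,\dots,0,1)\neq 0$. Let $\mathcal H_p=H^2_d\ominus pH^2_d$ and $S_j=P_{\mathcal H_p}M_{z_j}|_{\mathcal H_p}$. Call $U\subset\mathbb B_{d-1}$ admissible if $U$ is open, connected, contains $0$, is invariant under entrywise complex conjugation, and for every $\lambda\in U$ the polynomial $p(\lambda,\cdot)$ has precisely $n$ roots $\mu$, counted with multiplicity, with $(\lambda,\mu)\in\mathbb B_d$. Then some ball centred at the origin of $\mathbb C^{d-1}$ is admissible. For every admissible $U$, the tuple $(S_1^*,\dots,S_{d-1}^*)$ is in $B_n(U)$, and for every $\lambda\in U$ $$\bigcap_{j=1}^{d-1}\ker\big(S_j^*-\overline{\lambda_j}\big)=\operatorname{span}\big\{k^{(\ell)}_{(\lambda,\mu)} : p(\lambda,\mu)=0,\ 0\le \ell<\operatorname{mult}_\mu p(\lambda,\cdot)\big\}.$$ -/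

import Mathlib

open scoped Nat ComplexConjugate

noncomputable section

namespace DruryArveson

/-- `‖z^α‖² = α! / |α|!`, the squared norm of a monomial in the Drury-Arveson space. -/
def weight {d : ℕ} (α : Fin d →₀ ℕ) : ℝ := ((∏ i, (α i)! : ℕ) : ℝ) / ((∑ i, α i)! : ℕ)

theorem weight_pos {d : ℕ} (α : Fin d →₀ ℕ) : 0 < weight α := by
  unfold weight
  have h : 0 < ∏ i, (α i)! := Finset.prod_pos fun i _ => Nat.factorial_pos _
  have h' : 0 < (∑ i, α i)! := Nat.factorial_pos _
  positivity

/-- The Drury-Arveson space `H²_d`: the completion of `ℂ[z_1, …, z_d]` for the inner product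
`⟨z^α, z^β⟩ = δ_{αβ} α! / |α|!`, realized as the space of square summable coordinates `f α` with
respect to the orthonormal basis `z^α / ‖z^α‖`. -/
abbrev H2 (d : ℕ) : Type := lp (fun _ : Fin d →₀ ℕ => ℂ) 2

/-- The power series `∑ c_α z^α` of an element of `H²_d`. The coordinate of `f` along
`z^α / ‖z^α‖` is `f α`, so `c_α = f α / ‖z^α‖`. -/
def toSeries {d : ℕ} : H2 d →ₗ[ℂ] MvPowerSeries (Fin d) ℂ where
  toFun f := fun α => f α / (Real.sqrt (weight α) : ℂ)
  map_add' f g := by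
    funext α
    change (f α + g α) / _ = f α / _ + g α / _
    ring
  map_smul' c f := by
    funext α
    change (c * f α) / _ = c * (f α / _)
    ring

/-- The Taylor coefficient of `z^α` in `f`. -/
def coeff {d : ℕ} (f : H2 d) (α : Fin d →₀ ℕ) : ℂ := MvPowerSeries.coeff α (toSeries f)

theorem coeff_def {d : ℕ} (f : H2 d) (α : Fin d →₀ ℕ) :
    coeff f α = f α / (Real.sqrt (weight α) : ℂ) := rfl

theorem coe_eq {d : ℕ} (f : H2 d) (α : Fin d →₀ ℕ) :
    f α = (Real.sqrt (weight α) : ℂ) * coeff f α := by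
  have h : (Real.sqrt (weight α) : ℂ) ≠ 0 := by
    exact_mod_cast (Real.sqrt_pos.2 (weight_pos α)).ne'
  rw [coeff_def]
  field_simp

/-- The inner product of `H²_d` in terms of Taylor coefficients. -/
theorem inner_eq {d : ℕ} (f g : H2 d) :
    inner ℂ f g = ∑' α, (weight α : ℂ) * (conj (coeff f α) * coeff g α) := by
  rw [lp.inner_eq_tsum]
  refine tsum_congr fun α => ?_
  have h : (Real.sqrt (weight α) : ℂ) * (Real.sqrt (weight α) : ℂ) = (weight α : ℂ) := by
    exact_mod_cast Real.mul_self_sqrt (weight_pos α).le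
  rw [RCLike.inner_apply, coe_eq f α, coe_eq g α, map_mul, Complex.conj_ofReal, ← h]
  ring

/-- The value at `z` of the holomorphic function on the unit ball defined by `f`
(the series converges absolutely for `‖z‖ < 1`). -/
def eval {d : ℕ} (f : H2 d) (z : EuclideanSpace ℂ (Fin d)) : ℂ :=
  ∑' α : Fin d →₀ ℕ, coeff f α * ∏ i, z i ^ α i

/-- Coordinates of `z_j f`. -/
def shiftFun {d : ℕ} (j : Fin d) (f : H2 d) (β : Fin d →₀ ℕ) : ℂ :=
  if β j = 0 then 0 else (Real.sqrt (weight β) : ℂ) * coeff f (β - Finsupp.single j 1)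

theorem weight_add_single_le {d : ℕ} (j : Fin d) (α : Fin d →₀ ℕ) :
    weight (α + Finsupp.single j 1) ≤ weight α := by
  have h1 : ∑ i, (α + Finsupp.single j 1 : Fin d →₀ ℕ) i = (∑ i, α i) + 1 := by
    simp [Finset.sum_add_distrib, Finsupp.single_apply]
  have h2 : ∏ i, ((α + Finsupp.single j 1 : Fin d →₀ ℕ) i)! = (α j + 1) * ∏ i, (α i)! := by
    rw [← Finset.mul_prod_erase _ _ (Finset.mem_univ j),
      ← Finset.mul_prod_erase (f := fun i => (α i)!) _ (Finset.mem_univ j), ← mul_assoc]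
    congr 1
    · simp [Nat.factorial_succ]
    · refine Finset.prod_congr rfl fun i hi => ?_
      have : j ≠ i := (Finset.ne_of_mem_erase hi).symm
      simp [this]
  have h3 : α j ≤ ∑ i, α i := Finset.single_le_sum (fun _ _ => Nat.zero_le _) (Finset.mem_univ j)
  unfold weight
  rw [h1, h2, Nat.factorial_succ]
  have h4 : (0 : ℝ) < ((∑ i, α i)! : ℕ) := by exact_mod_cast Nat.factorial_pos _
  have h5 : ((α j : ℕ) : ℝ) ≤ ((∑ i, α i : ℕ) : ℝ) := by exact_mod_cast h3
  have h6 : (0 : ℝ) ≤ ((∏ i, (α i)! : ℕ) : ℝ) := Nat.cast_nonneg _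
  rw [Nat.cast_mul, Nat.cast_mul, Nat.cast_add, Nat.cast_one,
    Nat.cast_add (∑ i, α i) 1, Nat.cast_one, div_le_div_iff₀ (by positivity) h4]
  have h7 : (0 : ℝ) ≤ ((∏ i, (α i)! : ℕ) : ℝ) * ((∑ i, α i)! : ℕ) := by positivity
  nlinarith [mul_le_mul_of_nonneg_right h5 h7]

theorem shiftFun_add_single {d : ℕ} (j : Fin d) (f : H2 d) (α : Fin d →₀ ℕ) :
    shiftFun j f (α + Finsupp.single j 1)
      = (Real.sqrt (weight (α + Finsupp.single j 1)) : ℂ) * coeff f α := by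
  simp [shiftFun]

theorem shiftFun_of_notMem_range {d : ℕ} (j : Fin d) (f : H2 d) (β : Fin d →₀ ℕ)
    (hβ : β ∉ Set.range fun α : Fin d →₀ ℕ => α + Finsupp.single j 1) : shiftFun j f β = 0 := by
  by_contra h
  have hj : β j ≠ 0 := fun h0 => h (by simp [shiftFun, h0])
  refine hβ ⟨β - Finsupp.single j 1, ?_⟩
  refine tsub_add_cancel_of_le (Finsupp.single_le_iff.2 (Nat.one_le_iff_ne_zero.2 hj))

theorem norm_shiftFun_add_single_le {d : ℕ} (j : Fin d) (f : H2 d) (α : Fin d →₀ ℕ) :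
    ‖shiftFun j f (α + Finsupp.single j 1)‖ ≤ ‖f α‖ := by
  rw [shiftFun_add_single, coe_eq f α, norm_mul, norm_mul, Complex.norm_real, Complex.norm_real,
    Real.norm_of_nonneg (Real.sqrt_nonneg _), Real.norm_of_nonneg (Real.sqrt_nonneg _)]
  exact mul_le_mul_of_nonneg_right (Real.sqrt_le_sqrt (weight_add_single_le j α)) (norm_nonneg _)

theorem injective_add_single {d : ℕ} (j : Fin d) :
    Function.Injective fun α : Fin d →₀ ℕ => α + Finsupp.single j 1 :=
  add_left_injective _

theorem summable_sq {d : ℕ} (f : H2 d) : Summable fun α => ‖f α‖ ^ (2 : ℝ) := by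
  simpa using (lp.memℓp f).summable (by norm_num)

theorem summable_shiftFun {d : ℕ} (j : Fin d) (f : H2 d) :
    Summable fun β => ‖shiftFun j f β‖ ^ (2 : ℝ) := by
  rw [← (injective_add_single j).summable_iff]
  · refine (summable_sq f).of_nonneg_of_le (fun α => Real.rpow_nonneg (norm_nonneg _) _) fun α => ?_
    exact Real.rpow_le_rpow (norm_nonneg _) (norm_shiftFun_add_single_le j f α) (by norm_num)
  · intro β hβ
    simp [shiftFun_of_notMem_range j f β hβ]

/-- The element `z_j f` of `H²_d`. -/
def shiftElt {d : ℕ} (j : Fin d) (f : H2 d) : H2 d :=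
  ⟨shiftFun j f, memℓp_gen (by simpa using summable_shiftFun j f)⟩

theorem norm_shiftElt_le {d : ℕ} (j : Fin d) (f : H2 d) : ‖shiftElt j f‖ ≤ ‖f‖ := by
  refine lp.norm_le_of_tsum_le (by norm_num) (norm_nonneg f) ?_
  rw [lp.norm_rpow_eq_tsum (p := 2) (by norm_num) f]
  simp only [ENNReal.toReal_ofNat]
  change ∑' β, ‖shiftFun j f β‖ ^ (2 : ℝ) ≤ ∑' α, ‖f α‖ ^ (2 : ℝ)
  rw [← (injective_add_single j).tsum_eq]
  · refine Summable.tsum_le_tsum (fun α => ?_)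
      ((summable_shiftFun j f).comp_injective (injective_add_single j)) (summable_sq f)
    exact Real.rpow_le_rpow (norm_nonneg _) (norm_shiftFun_add_single_le j f α) (by norm_num)
  · intro β hβ
    by_contra h
    exact hβ (by simp [shiftFun_of_notMem_range j f β h])

/-- The operator `M_{z_j}` of multiplication by the `j`-th coordinate on `H²_d`. -/
def mulCoord {d : ℕ} (j : Fin d) : H2 d →L[ℂ] H2 d :=
  LinearMap.mkContinuous
    { toFun := shiftElt j
      map_add' := fun f g => by
        ext β
        change shiftFun j (f + g) β = shiftFun j f β + shiftFun j g β
        simp only [shiftFun, coeff, map_add]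
        split_ifs <;> ring
      map_smul' := fun c f => by
        ext β
        change shiftFun j (c • f) β = c * shiftFun j f β
        simp only [shiftFun, coeff, map_smul, smul_eq_mul]
        split_ifs <;> ring }
    1 (fun f => by simpa using norm_shiftElt_le j f)

/-- `M_{z_j}` is multiplication by `z_j`. -/
theorem toSeries_mulCoord {d : ℕ} (j : Fin d) (f : H2 d) :
    toSeries (mulCoord j f) = MvPowerSeries.X j * toSeries f := by
  ext β
  rw [mul_comm, MvPowerSeries.X, MvPowerSeries.coeff_mul_monomial, mul_one]
  change shiftFun j f β / (Real.sqrt (weight β) : ℂ) = _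
  have h : (Real.sqrt (weight β) : ℂ) ≠ 0 := by
    exact_mod_cast (Real.sqrt_pos.2 (weight_pos β)).ne'
  by_cases hj : β j = 0
  · simp [shiftFun, Finsupp.single_le_iff, hj]
  · rw [if_pos (Finsupp.single_le_iff.2 (Nat.one_le_iff_ne_zero.2 hj)), shiftFun, if_neg hj,
      mul_div_cancel_left₀ _ h, coeff]

/-- The subspace `p H²_d = {p f : f ∈ H²_d}`. -/
def polyMul {d : ℕ} (p : MvPolynomial (Fin d) ℂ) : Submodule ℂ (H2 d) where
  carrier := {g | ∃ f : H2 d, toSeries g = (p : MvPowerSeries (Fin d) ℂ) * toSeries f}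
  add_mem' := by
    rintro a b ⟨f, hf⟩ ⟨g, hg⟩
    exact ⟨f + g, by rw [map_add, map_add, hf, hg, mul_add]⟩
  zero_mem' := ⟨0, by simp⟩
  smul_mem' := by
    rintro c a ⟨f, hf⟩
    exact ⟨c • f, by rw [map_smul, map_smul, hf, mul_smul_comm]⟩

/-- `𝓗_p = H²_d ⊖ p H²_d`. -/
abbrev Hp {d : ℕ} (p : MvPolynomial (Fin d) ℂ) : Submodule ℂ (H2 d) := (polyMul p)ᗮ

/-- The compression `S_j = P_{𝓗_p} M_{z_j} |_{𝓗_p}` of the Arveson shift. -/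
def compressedShift {d : ℕ} (p : MvPolynomial (Fin d) ℂ) (j : Fin d) : Hp p →L[ℂ] Hp p :=
  (Hp p).orthogonalProjectionOnto ∘L mulCoord j ∘L (Hp p).subtypeL

/-- The tuple `(S_1^*, …, S_{d-1}^*)`, where `d = m + 1`. -/
def adjointTuple {m : ℕ} (p : MvPolynomial (Fin (m + 1)) ℂ) (j : Fin m) : Hp p →L[ℂ] Hp p :=
  ContinuousLinearMap.adjoint (compressedShift p j.castSucc)

/-- The point `(lam, μ) ∈ ℂ^{m+1}`. -/
def point {m : ℕ} (lam : EuclideanSpace ℂ (Fin m)) (μ : ℂ) : EuclideanSpace ℂ (Fin (m + 1)) :=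
  WithLp.toLp 2 (Fin.snoc (α := fun _ => ℂ) (fun i => lam i) μ)

/-- The entrywise complex conjugate of a vector. -/
def conjVec {m : ℕ} (lam : EuclideanSpace ℂ (Fin m)) : EuclideanSpace ℂ (Fin m) :=
  WithLp.toLp 2 fun i => conj (lam i)

/-- The one-variable polynomial `p(lam, ·)`. -/
def slice {m : ℕ} (p : MvPolynomial (Fin (m + 1)) ℂ) (lam : EuclideanSpace ℂ (Fin m)) :
    Polynomial ℂ :=
  MvPolynomial.aeval
    (Fin.snoc (α := fun _ => Polynomial ℂ) (fun i => Polynomial.C (lam i)) Polynomial.X) p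

/-- `k` is the vector `k_{(lam, μ)}^{(ℓ e_d)}`, that is, `⟨f, k⟩ = (∂/∂z_d)^ℓ f (lam, μ)` for all
`f ∈ H²_d`; for `ℓ = 0` this is the reproducing kernel at `(lam, μ)`. The inner product of Mathlib
is linear in its second argument. -/
def IsDerivKernel {m : ℕ} (lam : EuclideanSpace ℂ (Fin m)) (μ : ℂ) (l : ℕ) (k : H2 (m + 1)) :
    Prop :=
  ∀ f : H2 (m + 1), inner ℂ k f = iteratedDeriv l (fun t : ℂ => eval f (point lam t)) μ

open Classical in
/-- The neighbourhoods `U ⊆ 𝔹_{d-1}` of the origin over which the hypersurface `p = 0` is a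
branched cover with `n` sheets inside the ball `𝔹_d`: connected, open, invariant under complex
conjugation, and such that for every `lam ∈ U` the polynomial `p(lam, ·)` has precisely `n` roots
`μ`, counted with multiplicity, with `(lam, μ) ∈ 𝔹_d`. -/
structure IsBundleNhd {m : ℕ} (n : ℕ) (p : MvPolynomial (Fin (m + 1)) ℂ)
    (U : Set (EuclideanSpace ℂ (Fin m))) : Prop where
  isOpen : IsOpen U
  isConnected : IsConnected U
  zero_mem : 0 ∈ U
  subset_ball : U ⊆ Metric.ball 0 1
  conj_mem : ∀ lam ∈ U, conjVec lam ∈ U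
  roots_in_ball : ∀ lam ∈ U,
    (slice p lam).roots.countP (fun μ => point lam μ ∈ Metric.ball 0 1) = n

end DruryArveson

/-- The joint eigenspace `⋂_j ker (T_j - ω_j)`. -/
def jointKer {E : Type*} [NormedAddCommGroup E] [InnerProductSpace ℂ E] {m : ℕ}
    (T : Fin m → E →L[ℂ] E) (ω : EuclideanSpace ℂ (Fin m)) : Submodule ℂ E :=
  ⨅ j, LinearMap.ker ((T j - ω j • ContinuousLinearMap.id ℂ E : E →L[ℂ] E) : E →ₗ[ℂ] E)

/-- The Cowen-Douglas class `B_n(Ω)` of commuting `m`-tuples, for a domain `Ω ⊆ ℂ^m`: for `ω ∈ Ω`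
the operator `E → E ⊗ ℂ^m`, `h ↦ ((T_j - ω_j) h)_j`, has closed range and an `n`-dimensional
kernel, and these kernels together span a dense subspace. -/
structure IsCowenDouglas {E : Type*} [NormedAddCommGroup E] [InnerProductSpace ℂ E] {m : ℕ}
    (n : ℕ) (Ω : Set (EuclideanSpace ℂ (Fin m))) (T : Fin m → E →L[ℂ] E) : Prop where
  isOpen : IsOpen Ω
  isConnected : IsConnected Ω
  commute : ∀ i j, Commute (T i) (T j)
  isClosed_range : ∀ ω ∈ Ω,
    IsClosed (Set.range fun (h : E) (j : Fin m) => T j h - ω j • h)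
  finiteDimensional : ∀ ω ∈ Ω, FiniteDimensional ℂ (jointKer T ω)
  finrank_eq : ∀ ω ∈ Ω, Module.finrank ℂ (jointKer T ω) = n
  dense_span : (⨆ ω ∈ Ω, jointKer T ω).topologicalClosure = ⊤

end

noncomputable section

namespace DruryArveson

variable {d m n : ℕ}

/-! Since `p H²` is invariant under each `M_j`, the operator `S_j^*` is the restriction of `M_j^*`
to `Hp p`. A joint eigenvector at the conjugate of `lam` is therefore a vector orthogonal to `p H²`
and to every `(z_j - lam_j) H²`. By density of polynomials this means orthogonality to the ideal
generated by `p` and the `z_j - lam_j`, that is, to all `q` whose slice at `lam` is divisible by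
that of `p` (`map_jointKer_eq`). Divisibility is the vanishing of derivatives at the roots, so
duality in finite dimension yields the span of derivative kernels (`sliceSpace_eq_span_range`). Its
dimension is the degree `n` of the slice.

Closed range: for `w` in the ball, a Neumann series and `∑ M_j M_j^* = 1 - P_0`, with `P_0` the
projection onto constants, show that the ranges of the `M_j - w_j` together have codimension at most
one (`exists_eq_sum_sub`). Splitting the slice of `p` into linear factors gives finite codimension
of `∑ (z_j - lam_j) H² + p H²`, and duality turns this into closed range of the column of adjoints.

Density: if `f` in `Hp p` is orthogonal to all eigenspaces near `0`, scaling `(lam, μ)` by `s` gives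
a power series in `s` whose coefficients are derivatives of the homogeneous components of `f`. It
vanishes, so the slices of each component are divisible by those of `p`. As `p` is monic in the last
variable up to a scalar, `p` divides each component (`dvd_of_slice_dvd`). Hence `f` is orthogonal to
its own components and is zero. -/

theorem sqrt_weight_ne_zero (α : Fin d →₀ ℕ) : (Real.sqrt (weight α) : ℂ) ≠ 0 := by
  exact_mod_cast (Real.sqrt_pos.2 (weight_pos α)).ne'

/-! ### Polynomial multipliers and density of polynomials -/

theorem toSeries_injective : Function.Injective (toSeries (d := d)) := by
  intro f g h
  ext α
  have h1 : coeff f α = coeff g α := by rw [coeff, coeff, h]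
  rw [coe_eq f, coe_eq g, h1]

theorem exists_toSeries_eq_mul (q : MvPolynomial (Fin d) ℂ) (f : H2 d) :
    ∃ g : H2 d, toSeries g = (q : MvPowerSeries (Fin d) ℂ) * toSeries f := by
  induction q using MvPolynomial.induction_on with
  | C a =>
    refine ⟨a • f, ?_⟩
    rw [map_smul, MvPolynomial.coe_C, MvPowerSeries.smul_eq_C_mul]
  | add p q hp hq =>
    obtain ⟨g, hg⟩ := hp
    obtain ⟨g', hg'⟩ := hq
    exact ⟨g + g', by rw [map_add, hg, hg', MvPolynomial.coe_add, add_mul]⟩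
  | mul_X p j hp =>
    obtain ⟨g, hg⟩ := hp
    refine ⟨mulCoord j g, ?_⟩
    rw [toSeries_mulCoord, hg, MvPolynomial.coe_mul, MvPolynomial.coe_X]
    ring

/-- Multiplication by polynomials on `H²_d`. -/
def polyOp : MvPolynomial (Fin d) ℂ →ₐ[ℂ] Module.End ℂ (H2 d) where
  toFun q :=
    { toFun := fun f => (exists_toSeries_eq_mul q f).choose
      map_add' := fun f g => toSeries_injective <| by
        refine (exists_toSeries_eq_mul q _).choose_spec.trans ?_
        rw [map_add, map_add, mul_add]
        exact congrArg₂ _ (exists_toSeries_eq_mul q f).choose_spec.symm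
          (exists_toSeries_eq_mul q g).choose_spec.symm
      map_smul' := fun c f => toSeries_injective <| by
        refine (exists_toSeries_eq_mul q _).choose_spec.trans ?_
        rw [RingHom.id_apply, map_smul, map_smul, mul_smul_comm]
        exact congrArg _ (exists_toSeries_eq_mul q f).choose_spec.symm }
  map_one' := LinearMap.ext fun f => toSeries_injective <|
    (exists_toSeries_eq_mul _ _).choose_spec.trans (by simp)
  map_zero' := LinearMap.ext fun f => toSeries_injective <|
    (exists_toSeries_eq_mul _ _).choose_spec.trans (by simp)
  map_mul' p q := LinearMap.ext fun f => toSeries_injective <|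
    (exists_toSeries_eq_mul _ _).choose_spec.trans <| by
      refine .trans ?_ (exists_toSeries_eq_mul p _).choose_spec.symm
      rw [MvPolynomial.coe_mul, mul_assoc]
      congr 1
      exact (exists_toSeries_eq_mul q f).choose_spec.symm
  map_add' p q := LinearMap.ext fun f => toSeries_injective <|
    (exists_toSeries_eq_mul _ _).choose_spec.trans <| by
      refine .trans ?_ (map_add toSeries _ _).symm
      rw [MvPolynomial.coe_add, add_mul]
      exact congrArg₂ _ (exists_toSeries_eq_mul p f).choose_spec.symm
        (exists_toSeries_eq_mul q f).choose_spec.symm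
  commutes' c := LinearMap.ext fun f => toSeries_injective <|
    (exists_toSeries_eq_mul _ _).choose_spec.trans <| by
      rw [MvPolynomial.algebraMap_eq, MvPolynomial.coe_C, Module.algebraMap_end_apply, map_smul,
        MvPowerSeries.smul_eq_C_mul]

theorem toSeries_polyOp (q : MvPolynomial (Fin d) ℂ) (f : H2 d) :
    toSeries (polyOp q f) = (q : MvPowerSeries (Fin d) ℂ) * toSeries f :=
  (exists_toSeries_eq_mul q f).choose_spec

theorem polyOp_X (j : Fin d) (f : H2 d) : polyOp (MvPolynomial.X j) f = mulCoord j f :=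
  toSeries_injective <| by rw [toSeries_polyOp, toSeries_mulCoord, MvPolynomial.coe_X]

theorem polyOp_C (c : ℂ) (f : H2 d) : polyOp (MvPolynomial.C c) f = c • f := by
  rw [← MvPolynomial.algebraMap_eq, AlgHom.commutes, Module.algebraMap_end_apply]

theorem polyOp_X_sub_C (j : Fin d) (c : ℂ) (f : H2 d) :
    polyOp (MvPolynomial.X j - MvPolynomial.C c) f = mulCoord j f - c • f := by
  rw [map_sub, LinearMap.sub_apply, polyOp_X, polyOp_C]

theorem continuous_polyOp (q : MvPolynomial (Fin d) ℂ) : Continuous (polyOp q) := by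
  induction q using MvPolynomial.induction_on with
  | C a =>
    simp only [funext (polyOp_C a)]
    fun_prop
  | add p q hp hq =>
    rw [map_add]
    exact hp.add hq
  | mul_X p j hp =>
    rw [map_mul]
    refine hp.comp ?_
    simp only [funext (polyOp_X j)]
    fun_prop

theorem mem_polyMul {p : MvPolynomial (Fin d) ℂ} {g : H2 d} :
    g ∈ polyMul p ↔ ∃ f, polyOp p f = g := by
  refine exists_congr fun f => ⟨fun h => toSeries_injective ?_, ?_⟩
  · rw [toSeries_polyOp, h]
  · rintro rfl
    exact toSeries_polyOp p f

/-- The constant function `1`. -/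
def one : H2 d := lp.single 2 0 1

theorem weight_zero : weight (0 : Fin d →₀ ℕ) = 1 := by simp [weight]

theorem toSeries_one : toSeries (one : H2 d) = 1 := by
  classical
  ext α
  change (one : H2 d) α / _ = _
  rw [MvPowerSeries.coeff_one, one, lp.single_apply]
  by_cases h : α = 0
  · subst h
    simp [weight_zero]
  · simp [h]

/-- The embedding of the polynomials in `H²_d`. -/
def ofPoly : MvPolynomial (Fin d) ℂ →ₗ[ℂ] H2 d :=
  LinearMap.applyₗ one ∘ₗ polyOp.toLinearMap

theorem toSeries_ofPoly (q : MvPolynomial (Fin d) ℂ) :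
    toSeries (ofPoly q) = (q : MvPowerSeries (Fin d) ℂ) := by
  change toSeries (polyOp q one) = _
  rw [toSeries_polyOp, toSeries_one, mul_one]

theorem coeff_ofPoly (q : MvPolynomial (Fin d) ℂ) (α : Fin d →₀ ℕ) :
    coeff (ofPoly q) α = q.coeff α := by
  rw [coeff, toSeries_ofPoly, MvPolynomial.coeff_coe]

theorem polyOp_ofPoly (p q : MvPolynomial (Fin d) ℂ) : polyOp p (ofPoly q) = ofPoly (p * q) :=
  toSeries_injective <| by
    rw [toSeries_polyOp, toSeries_ofPoly, toSeries_ofPoly, MvPolynomial.coe_mul]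

theorem ofPoly_monomial (α : Fin d →₀ ℕ) (c : ℂ) :
    ofPoly (MvPolynomial.monomial α c) = lp.single 2 α ((Real.sqrt (weight α) : ℂ) * c) := by
  classical
  ext β
  rw [coe_eq, coeff_ofPoly, MvPolynomial.coeff_monomial, lp.single_apply]
  by_cases h : α = β
  · subst h
    simp
  · simp [h, Ne.symm h]

theorem ofPoly_monomial_coeff (f : H2 d) (α : Fin d →₀ ℕ) :
    ofPoly (MvPolynomial.monomial α (coeff f α)) = lp.single 2 α (f α) := by
  rw [ofPoly_monomial, ← coe_eq]

theorem hasSum_ofPoly_monomial (f : H2 d) :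
    HasSum (fun α => ofPoly (MvPolynomial.monomial α (coeff f α))) f := by
  simp only [ofPoly_monomial_coeff]
  exact lp.hasSum_single ENNReal.ofNat_ne_top f

theorem denseRange_ofPoly : DenseRange (ofPoly (d := d)) := by
  intro f
  refine mem_closure_of_tendsto (hasSum_ofPoly_monomial f) (.of_forall fun s => ?_)
  rw [← map_sum]
  exact Set.mem_range_self _

/-- Continuous linear functionals on `H²_d` are determined on polynomials. -/
theorem eq_of_inner_ofPoly {h k : H2 d} (H : ∀ q, inner ℂ h (ofPoly q) = inner ℂ k (ofPoly q)) :
    h = k := by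
  refine ext_inner_right ℂ fun f => ?_
  exact congrFun (denseRange_ofPoly.equalizer (g := fun f => inner ℂ h f)
    (h := fun f => inner ℂ k f) (by fun_prop) (by fun_prop) (funext H)) f

/-- Multiplication by `p` is continuous and polynomials are dense, so orthogonality to `p H²` need
only be tested on polynomial multiples of `p`. -/
theorem inner_polyOp_eq_zero {h : H2 d} {p : MvPolynomial (Fin d) ℂ}
    (H : ∀ q, inner ℂ h (ofPoly (p * q)) = 0) (f : H2 d) : inner ℂ h (polyOp p f) = 0 := by
  have hc := continuous_polyOp p
  exact congrFun (denseRange_ofPoly.equalizer (g := fun f => inner ℂ h (polyOp p f))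
    (h := fun _ => 0) (by fun_prop) (by fun_prop)
    (funext fun q => by simp only [Function.comp_apply, polyOp_ofPoly, H])) f

/-! ### Slices over a general coefficient ring -/

section GenericSlice

variable {A : Type*} [CommRing A] [Algebra ℂ A]

/-- Substitution of `x` for all variables except the last one. -/
def sliceHom (x : Fin m → A) : MvPolynomial (Fin (m + 1)) ℂ →ₐ[ℂ] Polynomial A :=
  MvPolynomial.aeval (Fin.snoc (α := fun _ => Polynomial A) (fun i => Polynomial.C (x i))
    Polynomial.X)

theorem sliceHom_X_castSucc (x : Fin m → A) (j : Fin m) :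
    sliceHom x (MvPolynomial.X j.castSucc) = Polynomial.C (x j) := by
  simp [sliceHom]

theorem sliceHom_X_last (x : Fin m → A) :
    sliceHom x (MvPolynomial.X (Fin.last m)) = Polynomial.X := by
  simp [sliceHom]

theorem sliceHom_C (x : Fin m → A) (c : ℂ) :
    sliceHom x (MvPolynomial.C c) = Polynomial.C (algebraMap ℂ A c) := by
  simp [sliceHom]

theorem sliceHom_monomial (x : Fin m → A) (α : Fin (m + 1) →₀ ℕ) (c : ℂ) :
    sliceHom x (MvPolynomial.monomial α c) =
      Polynomial.monomial (α (Fin.last m)) (algebraMap ℂ A c * ∏ i : Fin m, x i ^ α i.castSucc) := by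
  rw [sliceHom, MvPolynomial.aeval_monomial, Finsupp.prod_fintype _ _ (by simp),
    Fin.prod_univ_castSucc]
  simp only [Fin.snoc_castSucc, Fin.snoc_last]
  rw [← Polynomial.C_mul_X_pow_eq_monomial, map_mul, map_prod]
  simp only [map_pow]
  rw [mul_assoc]
  rfl

theorem sum_eq_of_mem_support {d : ℕ} {p : MvPolynomial (Fin d) ℂ} (hp : p.IsHomogeneous n)
    {α : Fin d →₀ ℕ} (hα : α ∈ p.support) : ∑ i, α i = n := by
  rw [hp.degree_eq_sum_deg_support hα]
  exact (Finset.sum_subset (Finset.subset_univ _) fun i _ hi => by simpa using hi).symm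

/-- Every other monomial of degree `n` contains a variable that vanishes at the last basis vector.
-/
theorem coeff_single_last {p : MvPolynomial (Fin (m + 1)) ℂ} (hp : p.IsHomogeneous n) :
    p.coeff (Finsupp.single (Fin.last m) n) = MvPolynomial.eval (Pi.single (Fin.last m) 1) p := by
  rw [MvPolynomial.eval_eq']
  rw [Finset.sum_eq_single (Finsupp.single (Fin.last m) n)]
  · rw [Finset.prod_eq_one, mul_one]
    intro i _
    by_cases h : i = Fin.last m
    · subst h; simp
    · simp [Ne.symm h]
  · intro α hα hne
    have hdeg := sum_eq_of_mem_support hp hα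
    have : ∃ i, i ≠ Fin.last m ∧ α i ≠ 0 := by
      by_contra! hcon
      refine hne (Finsupp.ext fun i => ?_)
      rw [Finset.sum_eq_single (Fin.last m) (fun i _ => hcon i) (by simp)] at hdeg
      by_cases h : i = Fin.last m
      · simp [h, hdeg]
      · simp [hcon i h, Ne.symm h]
    obtain ⟨i, hi, hi'⟩ := this
    rw [Finset.prod_eq_zero (Finset.mem_univ i), mul_zero]
    simp [hi, hi']
  · intro h
    rw [MvPolynomial.notMem_support_iff.1 h, zero_mul]

theorem natDegree_sliceHom_le {p : MvPolynomial (Fin (m + 1)) ℂ} (hp : p.IsHomogeneous n)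
    (x : Fin m → A) : (sliceHom x p).natDegree ≤ n := by
  rw [p.as_sum, map_sum]
  refine Polynomial.natDegree_sum_le_of_forall_le _ _ fun α hα => ?_
  rw [sliceHom_monomial]
  refine (Polynomial.natDegree_monomial_le _).trans ?_
  rw [hp.degree_eq_sum_deg_support hα]
  exact Finsupp.le_degree _ _

/-- By homogeneity the coefficient of the `n`-th power of the last variable is a constant. This
makes `p` monic up to a scalar in that variable, over any `A`. -/
theorem coeff_sliceHom {p : MvPolynomial (Fin (m + 1)) ℂ} (hp : p.IsHomogeneous n)
    (x : Fin m → A) : (sliceHom x p).coeff n =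
      algebraMap ℂ A (MvPolynomial.eval (Pi.single (Fin.last m) 1) p) := by
  rw [← coeff_single_last hp]
  conv_lhs => rw [p.as_sum, map_sum, Polynomial.finsetSum_coeff]
  rw [Finset.sum_eq_single (Finsupp.single (Fin.last m) n)]
  · rw [sliceHom_monomial]
    simp
  · intro α hα hne
    rw [sliceHom_monomial, Polynomial.coeff_monomial, if_neg]
    intro hlast
    refine hne ?_
    have hdeg := sum_eq_of_mem_support hp hα
    rw [Fin.sum_univ_castSucc, hlast] at hdeg
    have h0 : ∑ i : Fin m, α i.castSucc = 0 := by omega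
    rw [Finset.sum_eq_zero_iff] at h0
    ext i
    refine Fin.lastCases ?_ (fun i => ?_) i
    · simp [hlast]
    · simp [h0 i (Finset.mem_univ i), Fin.castSucc_ne_last i]
  · intro h
    rw [MvPolynomial.notMem_support_iff.1 h]
    simp

/-- Relates the slice over `MvPolynomial (Fin m) ℂ`, where division with remainder by `p` is done,
to the slices at points. -/
theorem sliceHom_map {B : Type*} [CommRing B] [Algebra ℂ B] (g : A →ₐ[ℂ] B) (x : Fin m → A)
    (p : MvPolynomial (Fin (m + 1)) ℂ) :
    (sliceHom x p).map (g : A →+* B) = sliceHom (fun i => g (x i)) p := by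
  have : (Polynomial.mapAlgHom g).comp (sliceHom x) = sliceHom fun i => g (x i) := by
    refine MvPolynomial.algHom_ext fun i => ?_
    refine Fin.lastCases ?_ (fun i => ?_) i
    · simp [sliceHom_X_last]
    · simp [sliceHom_X_castSucc]
  exact DFunLike.congr_fun this p

end GenericSlice

theorem slice_eq (p : MvPolynomial (Fin (m + 1)) ℂ) (lam : EuclideanSpace ℂ (Fin m)) :
    slice p lam = sliceHom (fun i => lam i) p := rfl

theorem eval_slice (q : MvPolynomial (Fin (m + 1)) ℂ) (lam : EuclideanSpace ℂ (Fin m)) (t : ℂ) :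
    (slice q lam).eval t = MvPolynomial.eval (point lam t) q := by
  have : (Polynomial.aeval t).comp (sliceHom fun i => lam i) =
      MvPolynomial.aeval (R := ℂ) (point lam t) := by
    refine MvPolynomial.algHom_ext fun i => ?_
    refine Fin.lastCases ?_ (fun i => ?_) i
    · simp [sliceHom_X_last, point]
    · simp [sliceHom_X_castSucc, point]
  have h := DFunLike.congr_fun this q
  simpa [MvPolynomial.aeval_eq_eval, slice_eq] using h

/-! ### Divisibility by `p` from divisibility of slices -/

section Homogeneous

variable {p : MvPolynomial (Fin (m + 1)) ℂ} (hp : p.IsHomogeneous n)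
  (hpd : MvPolynomial.eval (Pi.single (Fin.last m) 1) p ≠ 0)

include hp hpd

theorem natDegree_slice (lam : EuclideanSpace ℂ (Fin m)) : (slice p lam).natDegree = n := by
  refine le_antisymm (natDegree_sliceHom_le hp _) (Polynomial.le_natDegree_of_ne_zero ?_)
  rw [slice_eq, coeff_sliceHom hp]
  exact hpd

theorem slice_ne_zero (lam : EuclideanSpace ℂ (Fin m)) : slice p lam ≠ 0 := by
  intro h
  have := coeff_sliceHom hp fun i => lam i
  rw [← slice_eq, h, Polynomial.coeff_zero] at this
  exact hpd this.symm

/-- A polynomial all of whose slices near the origin are divisible by those of `p` is divisible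
by `p`. -/
theorem dvd_of_slice_dvd {r : ℝ} (hr : 0 < r) {q : MvPolynomial (Fin (m + 1)) ℂ}
    (H : ∀ lam ∈ Metric.ball (0 : EuclideanSpace ℂ (Fin m)) r, slice p lam ∣ slice q lam) :
    p ∣ q := by
  set c := MvPolynomial.eval (Pi.single (Fin.last m) 1) p with hc
  set P := sliceHom (A := MvPolynomial (Fin m) ℂ) MvPolynomial.X p with hP
  set Q := sliceHom (A := MvPolynomial (Fin m) ℂ) MvPolynomial.X q with hQ
  have hslice : ∀ (g : MvPolynomial (Fin (m + 1)) ℂ) (lam : EuclideanSpace ℂ (Fin m)),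
      (sliceHom (A := MvPolynomial (Fin m) ℂ) MvPolynomial.X g).map
        (MvPolynomial.aeval (R := ℂ) (fun i => lam i) : MvPolynomial (Fin m) ℂ →+* ℂ) =
        slice g lam := by
    intro g lam
    rw [slice_eq, sliceHom_map]
    simp
  have hmonic : (Polynomial.C (MvPolynomial.C c⁻¹) * P).Monic := by
    refine Polynomial.monic_of_natDegree_le_of_coeff_eq_one n ?_ ?_
    · exact (Polynomial.natDegree_C_mul_le _ _).trans (natDegree_sliceHom_le hp _)
    · rw [Polynomial.coeff_C_mul, hP, coeff_sliceHom hp, MvPolynomial.algebraMap_eq, ← map_mul,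
        inv_mul_cancel₀ hpd, map_one]
  set P₁ := Polynomial.C (MvPolynomial.C c⁻¹) * P with hP₁
  -- Division by a monic polynomial commutes with specialization, so the coefficients of the
  -- remainder are polynomials in `lam` vanishing on an open polydisc.
  have hmod : Q %ₘ P₁ = 0 := by
    refine Polynomial.ext fun k => ?_
    rw [Polynomial.coeff_zero]
    -- The polydisc of radius `r / (m + 1)` lies in the ball of radius `r`, because `m * r / (m + 1)
    -- < r`; this also covers `m = 0`.
    have hsub : ∀ x : Fin m → ℂ, (∀ i, x i ∈ Metric.ball (0 : ℂ) (r / (m + 1))) →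
        MvPolynomial.eval x ((Q %ₘ P₁).coeff k) = 0 := by
      intro x hx
      set lam : EuclideanSpace ℂ (Fin m) := WithLp.toLp 2 x with hlam
      have hmem : lam ∈ Metric.ball (0 : EuclideanSpace ℂ (Fin m)) r := by
        rw [mem_ball_zero_iff]
        have h1 : ‖lam‖ ≤ ∑ i, ‖x i‖ := by
          have : lam = ∑ i, EuclideanSpace.single i (x i) := by
            ext j
            simp [hlam, Finset.sum_apply]
          rw [this]
          refine (norm_sum_le _ _).trans_eq (Finset.sum_congr rfl fun i _ => ?_)
          simp
        have h2 : ∑ i, ‖x i‖ ≤ ∑ _i : Fin m, r / (m + 1) :=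
          Finset.sum_le_sum fun i _ => (mem_ball_zero_iff.1 (hx i)).le
        refine (h1.trans h2).trans_lt ?_
        rw [Finset.sum_const, Finset.card_univ, Fintype.card_fin, nsmul_eq_mul, mul_div_assoc',
          div_lt_iff₀ (by positivity)]
        nlinarith
      have hd := H lam hmem
      have hmap : slice q lam %ₘ (P₁.map
          (MvPolynomial.aeval (R := ℂ) (fun i => lam i) : MvPolynomial (Fin m) ℂ →+* ℂ)) = 0 := by
        rw [Polynomial.modByMonic_eq_zero_iff_dvd (hmonic.map _), hP₁, Polynomial.map_mul, hslice]
        refine (IsUnit.mul_left_dvd ?_).2 hd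
        rw [Polynomial.map_C, Polynomial.isUnit_C]
        simpa using hpd
      rw [← hslice, ← Polynomial.map_modByMonic _ hmonic] at hmap
      have := congrArg (fun g => Polynomial.coeff g k) hmap
      simpa [Polynomial.coeff_map, MvPolynomial.aeval_eq_eval, hlam] using this
    refine MvPolynomial.funext_set (fun _ => Metric.ball (0 : ℂ) (r / (m + 1))) (fun _ => ?_)
      fun x hx => ?_
    · exact infinite_of_mem_nhds 0 (Metric.ball_mem_nhds _ (by positivity))
    · rw [hsub x fun i => hx i (Set.mem_univ i), map_zero]
  rw [Polynomial.modByMonic_eq_zero_iff_dvd hmonic] at hmod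
  obtain ⟨G, hG⟩ := hmod
  let back : Polynomial (MvPolynomial (Fin m) ℂ) →+* MvPolynomial (Fin (m + 1)) ℂ :=
    Polynomial.eval₂RingHom
      (MvPolynomial.rename (R := ℂ) (Fin.castSucc (n := m)) : MvPolynomial (Fin m) ℂ →+* _)
      (MvPolynomial.X (Fin.last m))
  have hback : ∀ g, back (sliceHom (A := MvPolynomial (Fin m) ℂ) MvPolynomial.X g) = g := by
    intro g
    have : (back.comp (sliceHom (A := MvPolynomial (Fin m) ℂ) MvPolynomial.X :
        MvPolynomial (Fin (m + 1)) ℂ →+* _)) = RingHom.id _ := by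
      refine MvPolynomial.ringHom_ext (fun c => ?_) fun i => ?_
      · simp [back]
      · refine Fin.lastCases ?_ (fun i => ?_) i
        · simp [back, sliceHom_X_last]
        · simp [back, sliceHom_X_castSucc]
    exact DFunLike.congr_fun this g
  refine ⟨back (Polynomial.C (MvPolynomial.C c⁻¹)) * back G, ?_⟩
  rw [← hback q, ← hQ, hG, hP₁, map_mul, map_mul, hP, hback]
  ring

end Homogeneous

/-- The ideal of polynomials whose slice at `lam` is divisible by that of `p`. -/
theorem slice_dvd_iff (p q : MvPolynomial (Fin (m + 1)) ℂ) (lam : EuclideanSpace ℂ (Fin m)) :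
    slice p lam ∣ slice q lam ↔ q ∈ Ideal.span (insert p (Set.range fun j : Fin m =>
      MvPolynomial.X j.castSucc - MvPolynomial.C (lam j))) := by
  set J := Ideal.span (insert p (Set.range fun j : Fin m =>
      MvPolynomial.X j.castSucc - MvPolynomial.C (lam j))) with hJ
  constructor
  -- Modulo `J` each `z_j` equals `lam_j`, so `g` is congruent to its slice evaluated at the last
  -- variable.
  · have hmk : ∀ g, Ideal.Quotient.mk J g =
        Ideal.Quotient.mk J (Polynomial.aeval (MvPolynomial.X (Fin.last m)) (slice g lam)) := by
      intro g
      have : Ideal.Quotient.mkₐ ℂ J = (Ideal.Quotient.mkₐ ℂ J).comp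
          ((Polynomial.aeval (MvPolynomial.X (Fin.last m))).comp (sliceHom fun i => lam i)) := by
        refine MvPolynomial.algHom_ext fun i => ?_
        refine Fin.lastCases ?_ (fun i => ?_) i
        · simp [sliceHom_X_last]
        · simp only [AlgHom.comp_apply, sliceHom_X_castSucc, Polynomial.aeval_C]
          refine Ideal.Quotient.eq.2 (Ideal.subset_span ?_)
          exact Set.mem_insert_of_mem _ ⟨i, rfl⟩
      exact DFunLike.congr_fun this g
    rintro ⟨g, hg⟩
    rw [← Ideal.Quotient.eq_zero_iff_mem, hmk, hg, map_mul, map_mul, ← hmk p,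
      Ideal.Quotient.eq_zero_iff_mem.2 (Ideal.subset_span (Set.mem_insert _ _)), zero_mul]
  · intro hq
    have : J ≤ Ideal.comap (sliceHom fun i => lam i) (Ideal.span {slice p lam}) := by
      rw [hJ, Ideal.span_le, Set.insert_subset_iff]
      refine ⟨Ideal.subset_span rfl, ?_⟩
      rintro _ ⟨j, rfl⟩
      rw [SetLike.mem_coe, Ideal.mem_comap, map_sub, sliceHom_X_castSucc, sliceHom_C]
      simp
    exact Ideal.mem_span_singleton.1 (this hq)

/-! ### Reproducing kernels and derivative kernels -/

theorem inv_weight_eq_multinomial (α : Fin d →₀ ℕ) :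
    (weight α)⁻¹ = Nat.multinomial Finset.univ α := by
  have h1 : (0 : ℝ) < ((∏ i, (α i)! : ℕ) : ℝ) := by
    exact_mod_cast Finset.prod_pos fun i _ => Nat.factorial_pos _
  rw [weight, inv_div, div_eq_iff h1.ne', mul_comm]
  exact_mod_cast (Nat.multinomial_spec Finset.univ α).symm

/-- The multinomial series converges on the open `ℓ¹` ball. -/
theorem summable_multinomial {x : Fin d → ℝ} (hx : ∀ i, 0 ≤ x i) (hx1 : ∑ i, x i < 1) :
    Summable fun α : Fin d →₀ ℕ => (weight α)⁻¹ * ∏ i, x i ^ α i := by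
  classical
  simp only [inv_weight_eq_multinomial]
  suffices h : Summable fun k : Fin d → ℕ =>
      (Nat.multinomial Finset.univ k : ℝ) * ∏ i, x i ^ k i from
    h.comp_injective (i := fun α : Fin d →₀ ℕ => (α : Fin d → ℕ)) DFunLike.coe_injective
  have h0 : ∀ k : Fin d → ℕ, 0 ≤ (Nat.multinomial Finset.univ k : ℝ) * ∏ i, x i ^ k i :=
    fun k => mul_nonneg (Nat.cast_nonneg _) (Finset.prod_nonneg fun i _ => pow_nonneg (hx i) _)
  refine summable_of_sum_le (c := (1 - ∑ i, x i)⁻¹) h0 fun u => ?_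
  -- Multi-indices are grouped by total degree `j`; by the multinomial theorem each group
  -- contributes at most `(∑ i, x i) ^ j`.
  set N := u.sup fun k => ∑ i, k i
  have hmaps : ∀ k ∈ u, ∑ i, k i ∈ Finset.range (N + 1) := fun k hk =>
    Finset.mem_range.2 (Nat.lt_succ_of_le (Finset.le_sup (f := fun k => ∑ i, k i) hk))
  rw [← Finset.sum_fiberwise_of_maps_to hmaps]
  have hs : 0 ≤ ∑ i, x i := Finset.sum_nonneg fun i _ => hx i
  calc _ ≤ ∑ j ∈ Finset.range (N + 1), (∑ i, x i) ^ j := by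
        refine Finset.sum_le_sum fun j _ => ?_
        rw [Finset.sum_pow_eq_sum_piAntidiag]
        refine Finset.sum_le_sum_of_subset_of_nonneg (fun k hk => ?_) fun k _ _ => h0 k
        simpa using (Finset.mem_filter.1 hk).2
    _ ≤ ∑' j, (∑ i, x i) ^ j :=
        (summable_geometric_of_lt_one hs hx1).sum_le_tsum _ fun _ _ => pow_nonneg hs _
    _ = _ := tsum_geometric_of_lt_one hs hx1

/-- Coordinates of the reproducing kernel at `z`. -/
def kernelFun (z : EuclideanSpace ℂ (Fin d)) (α : Fin d →₀ ℕ) : ℂ :=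
  conj (∏ i, z i ^ α i) / (Real.sqrt (weight α) : ℂ)

theorem norm_kernelFun (z : EuclideanSpace ℂ (Fin d)) (α : Fin d →₀ ℕ) :
    ‖kernelFun z α‖ = (∏ i, ‖z i‖ ^ α i) / Real.sqrt (weight α) := by
  rw [kernelFun, norm_div, RCLike.norm_conj, norm_prod, Complex.norm_real,
    Real.norm_of_nonneg (Real.sqrt_nonneg _)]
  simp only [norm_pow]

/-- The squared norm is the multinomial series at `x i = ‖z i‖ ^ 2`, and these numbers add up to
`‖z‖ ^ 2 < 1`. -/
theorem summable_kernelFun {z : EuclideanSpace ℂ (Fin d)} (hz : ‖z‖ < 1) :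
    Summable fun α => ‖kernelFun z α‖ ^ (2 : ℝ) := by
  have h1 : ∑ i, ‖z i‖ ^ 2 < 1 := by
    rw [← EuclideanSpace.norm_sq_eq]
    exact pow_lt_one₀ (norm_nonneg _) hz two_ne_zero
  refine (summable_multinomial (fun i => sq_nonneg _) h1).congr fun α => ?_
  rw [norm_kernelFun, Real.rpow_two, div_pow, Real.sq_sqrt (weight_pos α).le, div_eq_inv_mul,
    ← Finset.prod_pow]
  simp only [← pow_mul, mul_comm]

/-- The reproducing kernel at `z`. -/
def kernel (z : EuclideanSpace ℂ (Fin d)) (hz : ‖z‖ < 1) : H2 d :=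
  ⟨kernelFun z, memℓp_gen (by simpa using summable_kernelFun hz)⟩

/-- Used with `w = (lam, R)` to bound all point evaluations at `(lam, t)`, `|t| < R`, by one
constant. -/
theorem norm_kernel_le {z w : EuclideanSpace ℂ (Fin d)} (hz : ‖z‖ < 1) (hw : ‖w‖ < 1)
    (h : ∀ i, ‖z i‖ ≤ ‖w i‖) : ‖kernel z hz‖ ≤ ‖kernel w hw‖ := by
  refine lp.norm_le_of_tsum_le (by norm_num) (norm_nonneg _) ?_
  rw [lp.norm_rpow_eq_tsum (p := 2) (by norm_num) (kernel w hw)]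
  simp only [ENNReal.toReal_ofNat]
  refine Summable.tsum_le_tsum (fun α => ?_) (summable_kernelFun hz) (summable_kernelFun hw)
  refine Real.rpow_le_rpow (norm_nonneg _) ?_ (by norm_num)
  change ‖kernelFun z α‖ ≤ ‖kernelFun w α‖
  rw [norm_kernelFun, norm_kernelFun]
  gcongr
  exact h _

theorem inner_kernel_term (z : EuclideanSpace ℂ (Fin d)) (hz : ‖z‖ < 1) (f : H2 d)
    (α : Fin d →₀ ℕ) :
    inner ℂ (kernel z hz α) (f α) = coeff f α * ∏ i, z i ^ α i := by
  change inner ℂ (kernelFun z α) (f α) = _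
  rw [RCLike.inner_apply, kernelFun, coeff_def, map_div₀, Complex.conj_conj, Complex.conj_ofReal]
  ring

theorem inner_kernel (z : EuclideanSpace ℂ (Fin d)) (hz : ‖z‖ < 1) (f : H2 d) :
    inner ℂ (kernel z hz) f = eval f z := by
  rw [lp.inner_eq_tsum]
  exact tsum_congr fun α => inner_kernel_term z hz f α

theorem summable_eval {z : EuclideanSpace ℂ (Fin d)} (hz : ‖z‖ < 1) (f : H2 d) :
    Summable fun α => ‖coeff f α * ∏ i, z i ^ α i‖ :=
  ((lp.summable_inner (kernel z hz) f).congr fun α => inner_kernel_term z hz f α).norm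

theorem eval_ofPoly (q : MvPolynomial (Fin d) ℂ) (z : EuclideanSpace ℂ (Fin d)) :
    eval (ofPoly q) z = MvPolynomial.eval z q := by
  rw [eval, MvPolynomial.eval_eq', tsum_eq_sum (s := q.support)]
  · simp only [coeff_ofPoly]
  · intro α hα
    rw [coeff_ofPoly, MvPolynomial.notMem_support_iff.1 hα, zero_mul]

theorem norm_point_sq (lam : EuclideanSpace ℂ (Fin m)) (μ : ℂ) :
    ‖point lam μ‖ ^ 2 = ‖lam‖ ^ 2 + ‖μ‖ ^ 2 := by
  rw [EuclideanSpace.norm_sq_eq, EuclideanSpace.norm_sq_eq, Fin.sum_univ_castSucc]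
  simp [point]

theorem norm_point_lt_one_iff {lam : EuclideanSpace ℂ (Fin m)} {μ : ℂ} :
    ‖point lam μ‖ < 1 ↔ ‖lam‖ ^ 2 + ‖μ‖ ^ 2 < 1 := by
  rw [← norm_point_sq, sq_lt_one_iff₀ (norm_nonneg _)]

theorem exists_radius {lam : EuclideanSpace ℂ (Fin m)} {μ : ℂ} (h : ‖point lam μ‖ < 1) :
    ∃ R : ℝ, ‖μ‖ < R ∧ ‖point lam (R : ℂ)‖ < 1 := by
  rw [norm_point_lt_one_iff] at h
  obtain ⟨R, h1, h2⟩ := exists_between (Real.lt_sqrt_of_sq_lt (x := ‖μ‖) (y := 1 - ‖lam‖ ^ 2)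
    (by linarith))
  have h0 : 0 ≤ R := (norm_nonneg _).trans h1.le
  refine ⟨R, h1, ?_⟩
  rw [norm_point_lt_one_iff, Complex.norm_real, Real.norm_of_nonneg h0]
  have := (Real.lt_sqrt h0).1 h2
  linarith

theorem norm_point_apply_le {lam : EuclideanSpace ℂ (Fin m)} {s t : ℂ} (h : ‖s‖ ≤ ‖t‖)
    (i : Fin (m + 1)) : ‖point lam s i‖ ≤ ‖point lam t i‖ := by
  refine Fin.lastCases ?_ (fun i => ?_) i
  · simpa [point] using h
  · simp [point]

theorem norm_point_lt_of_le {lam : EuclideanSpace ℂ (Fin m)} {s t : ℂ} (h : ‖s‖ ≤ ‖t‖)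
    (ht : ‖point lam t‖ < 1) : ‖point lam s‖ < 1 := by
  rw [norm_point_lt_one_iff] at ht ⊢
  have : ‖s‖ ^ 2 ≤ ‖t‖ ^ 2 := by gcongr
  linarith

theorem norm_le_of_mem_ball {R : ℝ} {s : ℂ} (hs : s ∈ Metric.ball (0 : ℂ) R) :
    ‖s‖ ≤ ‖(R : ℂ)‖ := by
  rw [mem_ball_zero_iff] at hs
  rw [Complex.norm_real]
  exact hs.le.trans (le_abs_self R)

theorem differentiableOn_eval_point (f : H2 (m + 1)) {lam : EuclideanSpace ℂ (Fin m)} {R : ℝ}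
    (hR : ‖point lam (R : ℂ)‖ < 1) :
    DifferentiableOn ℂ (fun t => eval f (point lam t)) (Metric.ball 0 R) := by
  refine Complex.differentiableOn_tsum_of_summable_norm (summable_eval hR f) (fun α => ?_)
    Metric.isOpen_ball fun α t ht => ?_
  · simp only [Fin.prod_univ_castSucc, point, Fin.snoc_castSucc, Fin.snoc_last]
    fun_prop
  · rw [norm_mul, norm_mul, norm_prod, norm_prod]
    simp only [norm_pow]
    gcongr with i
    exact norm_point_apply_le (norm_le_of_mem_ball ht) i

theorem norm_eval_point_le (f : H2 (m + 1)) {lam : EuclideanSpace ℂ (Fin m)} {R : ℝ}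
    (hR : ‖point lam (R : ℂ)‖ < 1) {t : ℂ} (ht : t ∈ Metric.ball (0 : ℂ) R) :
    ‖eval f (point lam t)‖ ≤ ‖kernel _ hR‖ * ‖f‖ := by
  have hle := norm_le_of_mem_ball ht
  rw [← inner_kernel _ (norm_point_lt_of_le hle hR)]
  refine (norm_inner_le_norm _ _).trans ?_
  gcongr
  exact norm_kernel_le _ _ (norm_point_apply_le hle)

/-- Riesz representation: Cauchy's estimate on a small circle about `μ`, with the uniform bound for
point evaluations, makes the derivative functional bounded. -/
theorem exists_isDerivKernel {lam : EuclideanSpace ℂ (Fin m)} {μ : ℂ} (h : ‖point lam μ‖ < 1)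
    (l : ℕ) : ∃ k, IsDerivKernel lam μ l k := by
  obtain ⟨R, hμ, hR⟩ := exists_radius h
  have hmem : μ ∈ Metric.ball (0 : ℂ) R := mem_ball_zero_iff.2 hμ
  have hnhds : Metric.ball (0 : ℂ) R ∈ nhds μ := Metric.isOpen_ball.mem_nhds hmem
  have hcd : ∀ f : H2 (m + 1), ContDiffAt ℂ l (fun t => eval f (point lam t)) μ := fun f =>
    ((differentiableOn_eval_point f hR).analyticAt hnhds).contDiffAt
  have hlin : ∀ t (ht : t ∈ Metric.ball (0 : ℂ) R) f, eval f (point lam t) =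
      inner ℂ (kernel _ (norm_point_lt_of_le (norm_le_of_mem_ball ht) hR)) f :=
    fun t ht f => (inner_kernel _ _ f).symm
  let L : H2 (m + 1) →ₗ[ℂ] ℂ :=
    { toFun := fun f => iteratedDeriv l (fun t => eval f (point lam t)) μ
      map_add' := fun f g => by
        rw [← iteratedDeriv_add (hcd f) (hcd g)]
        refine Filter.EventuallyEq.iteratedDeriv_eq l ?_
        filter_upwards [hnhds] with t ht
        rw [Pi.add_apply, hlin t ht, hlin t ht, hlin t ht, inner_add_right]
      map_smul' := fun c f => by
        rw [RingHom.id_apply, ← iteratedDeriv_const_smul (hcd f)]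
        refine Filter.EventuallyEq.iteratedDeriv_eq l ?_
        filter_upwards [hnhds] with t ht
        rw [Pi.smul_apply, hlin t ht, hlin t ht, inner_smul_right, smul_eq_mul] }
  obtain ⟨ε, hε, hball⟩ := Metric.nhds_basis_closedBall.mem_iff.1 hnhds
  let L' : H2 (m + 1) →L[ℂ] ℂ := L.mkContinuous (l ! * ‖kernel _ hR‖ / ε ^ l) fun f => by
    have hd : DiffContOnCl ℂ (fun t => eval f (point lam t)) (Metric.ball μ ε) :=
      ((differentiableOn_eval_point f hR).mono
        (Metric.closure_ball_subset_closedBall.trans hball)).diffContOnCl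
    refine (Complex.norm_iteratedDeriv_le_of_forall_mem_sphere_norm_le l hε hd fun t ht =>
      norm_eval_point_le f hR (hball (Metric.sphere_subset_closedBall ht))).trans_eq ?_
    ring
  refine ⟨(InnerProductSpace.toDual ℂ _).symm L', fun f => ?_⟩
  rw [InnerProductSpace.toDual_symm_apply]
  rfl

theorem iteratedDeriv_polynomial_eval (q : Polynomial ℂ) (l : ℕ) :
    iteratedDeriv l (fun t => q.eval t) = fun t => (Polynomial.derivative^[l] q).eval t := by
  induction l with
  | zero => simp
  | succ l ih =>
    rw [iteratedDeriv_succ, ih, Function.iterate_succ_apply']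
    funext t
    exact Polynomial.deriv _

theorem IsDerivKernel.inner_ofPoly {lam : EuclideanSpace ℂ (Fin m)} {μ : ℂ} {l : ℕ}
    {k : H2 (m + 1)} (hk : IsDerivKernel lam μ l k) (q : MvPolynomial (Fin (m + 1)) ℂ) :
    inner ℂ k (ofPoly q) = (Polynomial.derivative^[l] (slice q lam)).eval μ := by
  rw [hk]
  simp only [eval_ofPoly, ← eval_slice]
  rw [iteratedDeriv_polynomial_eval]

/-! ### Adjoints of the compressions and their joint eigenspaces -/

theorem adjoint_mulCoord_mem (p : MvPolynomial (Fin d) ℂ) (j : Fin d) {h : H2 d} (hh : h ∈ Hp p) :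
    ContinuousLinearMap.adjoint (mulCoord j) h ∈ Hp p := by
  rw [Submodule.mem_orthogonal'] at hh ⊢
  intro g hg
  obtain ⟨f, rfl⟩ := mem_polyMul.1 hg
  rw [ContinuousLinearMap.adjoint_inner_left, ← polyOp_X]
  refine hh _ (mem_polyMul.2 ⟨polyOp (MvPolynomial.X j) f, ?_⟩)
  rw [← Module.End.mul_apply, ← map_mul, mul_comm, map_mul, Module.End.mul_apply]

/-- `Hp p` is invariant under `M_j^*`, so no projection is needed on the adjoint side. -/
theorem coe_adjoint_compressedShift (p : MvPolynomial (Fin d) ℂ) (j : Fin d) (h : Hp p) :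
    (ContinuousLinearMap.adjoint (compressedShift p j) h : H2 d) =
      ContinuousLinearMap.adjoint (mulCoord j) (h : H2 d) := by
  have : ContinuousLinearMap.adjoint (compressedShift p j) h =
      ⟨_, adjoint_mulCoord_mem p j h.2⟩ := by
    refine ext_inner_right ℂ fun y => ?_
    rw [ContinuousLinearMap.adjoint_inner_left, Submodule.coe_inner, Submodule.coe_inner,
      ContinuousLinearMap.adjoint_inner_left]
    exact Submodule.inner_orthogonalProjectionOnto_eq_of_mem_left h (mulCoord j y)
  rw [this]

theorem mulCoord_comm (i j : Fin d) (f : H2 d) :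
    mulCoord i (mulCoord j f) = mulCoord j (mulCoord i f) := by
  simp only [← polyOp_X]
  rw [← Module.End.mul_apply, ← map_mul, mul_comm, map_mul, Module.End.mul_apply]

theorem commute_adjointTuple (p : MvPolynomial (Fin (m + 1)) ℂ) (i j : Fin m) :
    Commute (adjointTuple p i) (adjointTuple p j) := by
  refine ContinuousLinearMap.ext fun h => Subtype.ext ?_
  rw [mul_apply_eq_comp, mul_apply_eq_comp]
  simp only [adjointTuple, coe_adjoint_compressedShift]
  refine ext_inner_right ℂ fun y => ?_
  simp only [ContinuousLinearMap.adjoint_inner_left]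
  rw [mulCoord_comm]

/-- The orthogonal complement in `H²_d` of the polynomials whose slice at `lam` is divisible by
that of `p`. -/
def sliceSpace (p : MvPolynomial (Fin (m + 1)) ℂ) (lam : EuclideanSpace ℂ (Fin m)) :
    Submodule ℂ (H2 (m + 1)) :=
  (Submodule.map ofPoly ((Ideal.span (insert p (Set.range fun j : Fin m =>
    MvPolynomial.X j.castSucc - MvPolynomial.C (lam j)))).restrictScalars ℂ))ᗮ

theorem mem_sliceSpace {p : MvPolynomial (Fin (m + 1)) ℂ} {lam : EuclideanSpace ℂ (Fin m)}
    {h : H2 (m + 1)} :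
    h ∈ sliceSpace p lam ↔ ∀ q, slice p lam ∣ slice q lam → inner ℂ h (ofPoly q) = 0 := by
  rw [sliceSpace, Submodule.mem_orthogonal']
  simp only [slice_dvd_iff]
  constructor
  · exact fun H q hq => H _ (Submodule.mem_map_of_mem hq)
  · rintro H _ ⟨q, hq, rfl⟩
    exact H q hq

theorem map_jointKer_eq (p : MvPolynomial (Fin (m + 1)) ℂ) (lam : EuclideanSpace ℂ (Fin m)) :
    (jointKer (adjointTuple p) (conjVec lam)).map (Hp p).subtype = sliceSpace p lam := by
  have key : ∀ h : Hp p, h ∈ jointKer (adjointTuple p) (conjVec lam) ↔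
      ∀ (j : Fin m) (f : H2 (m + 1)), inner ℂ (h : H2 (m + 1)) (polyOp
        (MvPolynomial.X j.castSucc - MvPolynomial.C (lam j)) f) = 0 := by
    intro h
    rw [jointKer, Submodule.mem_iInf]
    refine forall_congr' fun j => ?_
    change adjointTuple p j h - conj (lam j) • h = 0 ↔ _
    rw [← Submodule.coe_eq_zero, Submodule.coe_sub, Submodule.coe_smul, adjointTuple,
      coe_adjoint_compressedShift]
    have : ∀ f, inner ℂ (h : H2 (m + 1)) (polyOp
        (MvPolynomial.X j.castSucc - MvPolynomial.C (lam j)) f) =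
        inner ℂ (ContinuousLinearMap.adjoint (mulCoord j.castSucc) (h : H2 (m + 1))
          - conj (lam j) • (h : H2 (m + 1))) f := by
      intro f
      rw [polyOp_X_sub_C, inner_sub_right, inner_sub_left, inner_smul_right, inner_smul_left,
        ContinuousLinearMap.adjoint_inner_left, Complex.conj_conj]
    simp only [this]
    constructor
    · intro h0 f
      rw [h0, inner_zero_left]
    · exact fun H => ext_inner_right ℂ fun f => by rw [H, inner_zero_left]
  ext h
  rw [mem_sliceSpace, Submodule.mem_map]
  constructor
  · rintro ⟨h, hh, rfl⟩ q hq
    rw [key] at hh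
    -- The `q` with `h` orthogonal to `q H²` form an ideal, so only the generators have to be
    -- checked.
    have hle : Ideal.span (insert p (Set.range fun j : Fin m =>
        MvPolynomial.X j.castSucc - MvPolynomial.C (lam j))) ≤
        { carrier := {q | ∀ f, inner ℂ (h : H2 (m + 1)) (polyOp q f) = 0}
          add_mem' := fun {a b} ha hb f => by
            rw [map_add, LinearMap.add_apply, inner_add_right, ha, hb, add_zero]
          zero_mem' := fun f => by simp
          smul_mem' := fun c a ha f => by
            rw [smul_eq_mul, mul_comm, map_mul]
            exact ha _ } := by
      rw [Ideal.span_le, Set.insert_subset_iff]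
      refine ⟨fun f => (Submodule.mem_orthogonal' _ _).1 h.2 _ (mem_polyMul.2 ⟨f, rfl⟩), ?_⟩
      rintro _ ⟨j, rfl⟩
      exact hh j
    exact hle ((slice_dvd_iff p q lam).1 hq) one
  · intro H
    have hmem : h ∈ Hp p := by
      rw [Submodule.mem_orthogonal']
      intro g hg
      obtain ⟨f, rfl⟩ := mem_polyMul.1 hg
      refine inner_polyOp_eq_zero (fun q => H _ ?_) f
      rw [slice_eq, slice_eq, map_mul]
      exact dvd_mul_right _ _
    refine ⟨⟨h, hmem⟩, (key _).2 fun j f => inner_polyOp_eq_zero (fun q => H _ ?_) f, rfl⟩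
    rw [slice_eq p, slice_eq, map_mul, map_sub, sliceHom_X_castSucc, sliceHom_C]
    simp

/-- Divisibility of complex polynomials in terms of derivatives at the roots of the divisor. -/
theorem dvd_iff_derivative_eval {P Q : Polynomial ℂ} (hP : P ≠ 0) :
    P ∣ Q ↔ ∀ μ l, l < P.rootMultiplicity μ → (Polynomial.derivative^[l] Q).eval μ = 0 := by
  constructor
  · rintro h μ l hl
    rcases eq_or_ne Q 0 with rfl | hQ
    · simp
    · exact Polynomial.isRoot_iterate_derivative_of_lt_rootMultiplicity
        (hl.trans_le (Polynomial.rootMultiplicity_le_rootMultiplicity_of_dvd hQ h μ))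
  · intro H
    rcases eq_or_ne Q 0 with rfl | hQ
    · exact dvd_zero _
    -- Over `ℂ` divisibility is inclusion of root multisets, and in characteristic zero the
    -- vanishing derivatives determine multiplicities.
    refine (IsAlgClosed.splits P).dvd_of_roots_le_roots hP ?_
    rw [Multiset.le_iff_count]
    intro μ
    rw [Polynomial.count_roots, Polynomial.count_roots]
    by_contra! hlt
    refine lt_irrefl _ ((Polynomial.lt_rootMultiplicity_iff_isRoot_iterate_derivative hQ).2
      fun l hl => H μ l (hl.trans_lt hlt))

theorem slice_aeval_X_last (g : Polynomial ℂ) (lam : EuclideanSpace ℂ (Fin m)) :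
    slice (Polynomial.aeval (MvPolynomial.X (Fin.last m) : MvPolynomial (Fin (m + 1)) ℂ) g) lam
      = g := by
  rw [slice_eq, ← Polynomial.aeval_algHom_apply, sliceHom_X_last, Polynomial.aeval_X_left_apply]

/-! ### Spanning by derivative kernels and the dimension count -/

section Kernels

variable {p : MvPolynomial (Fin (m + 1)) ℂ} {lam : EuclideanSpace ℂ (Fin m)}
  (h0 : slice p lam ≠ 0) (hball : ∀ μ ∈ (slice p lam).roots, ‖point lam μ‖ < 1)

include h0 hball

omit hball in
theorem IsDerivKernel.mem_sliceSpace {μ : ℂ} {l : ℕ} (hl : l < (slice p lam).rootMultiplicity μ)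
    {k : H2 (m + 1)} (hk : IsDerivKernel lam μ l k) : k ∈ sliceSpace p lam := by
  rw [DruryArveson.mem_sliceSpace]
  intro q hq
  rw [hk.inner_ofPoly]
  exact (dvd_iff_derivative_eval h0).1 hq _ _ hl

omit h0 in
theorem exists_kernels : ∃ k : (Σ μ : (slice p lam).roots.toFinset,
    Fin ((slice p lam).rootMultiplicity μ.1)) → H2 (m + 1), ∀ i, IsDerivKernel lam i.1 i.2 (k i) :=
  Classical.skolem.1 fun i =>
    exists_isDerivKernel (hball i.1 (Multiset.mem_toFinset.1 i.1.2)) i.2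

omit hball in
-- A functional on polynomials that vanishes on the common kernel of finitely many functionals is a
-- combination of them; here the common kernel consists of the `q` whose slice is divisible by that
-- of `p`.
theorem sliceSpace_eq_span_range {k : (Σ μ : (slice p lam).roots.toFinset,
    Fin ((slice p lam).rootMultiplicity μ.1)) → H2 (m + 1)}
    (hk : ∀ i, IsDerivKernel lam i.1 i.2 (k i)) :
    sliceSpace p lam = Submodule.span ℂ (Set.range k) := by
  refine le_antisymm (fun h hh => ?_) ?_
  · rw [mem_sliceSpace] at hh
    let L : H2 (m + 1) → Module.Dual ℂ (MvPolynomial (Fin (m + 1)) ℂ) := fun h =>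
      (innerSL ℂ h : H2 (m + 1) →ₗ[ℂ] ℂ) ∘ₗ ofPoly
    have hL : L h ∈ Submodule.span ℂ (Set.range fun i => L (k i)) := by
      refine mem_span_of_iInf_ker_le_ker fun q hq => hh q ?_
      rw [dvd_iff_derivative_eval h0]
      intro μ l hl
      have hμ : μ ∈ (slice p lam).roots.toFinset := by
        rw [Multiset.mem_toFinset, Polynomial.mem_roots h0,
          ← Polynomial.rootMultiplicity_pos h0]
        exact (Nat.zero_le _).trans_lt hl
      have := (Submodule.mem_iInf _).1 hq ⟨⟨μ, hμ⟩, ⟨l, hl⟩⟩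
      rw [← (hk ⟨⟨μ, hμ⟩, ⟨l, hl⟩⟩).inner_ofPoly]
      exact this
    obtain ⟨c, hc⟩ := (Submodule.mem_span_range_iff_exists_fun ℂ).1 hL
    rw [Submodule.mem_span_range_iff_exists_fun]
    -- Conjugates appear because the inner product is conjugate linear in its first argument.
    refine ⟨fun i => conj (c i), eq_of_inner_ofPoly fun q => ?_⟩
    have hcq := DFunLike.congr_fun hc q
    rw [LinearMap.sum_apply] at hcq
    rw [sum_inner]
    refine Eq.trans (Finset.sum_congr rfl fun i _ => ?_) hcq
    rw [inner_smul_left, Complex.conj_conj]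
    rfl
  · rw [Submodule.span_le]
    rintro _ ⟨i, rfl⟩
    exact (hk i).mem_sliceSpace h0 i.2.2

theorem sliceSpace_eq_span : sliceSpace p lam =
    Submodule.span ℂ {k : H2 (m + 1) | ∃ (μ : ℂ) (l : ℕ),
      l < (slice p lam).rootMultiplicity μ ∧ IsDerivKernel lam μ l k} := by
  obtain ⟨k, hk⟩ := exists_kernels hball
  refine le_antisymm ?_ ?_
  · rw [sliceSpace_eq_span_range h0 hk]
    refine Submodule.span_mono ?_
    rintro _ ⟨i, rfl⟩
    exact ⟨i.1, i.2, i.2.2, hk i⟩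
  · rw [Submodule.span_le]
    rintro k ⟨μ, l, hl, hk⟩
    exact hk.mem_sliceSpace h0 hl

theorem finiteDimensional_sliceSpace : FiniteDimensional ℂ (sliceSpace p lam) := by
  obtain ⟨k, hk⟩ := exists_kernels hball
  rw [sliceSpace_eq_span_range h0 hk]
  exact FiniteDimensional.span_of_finite ℂ (Set.finite_range k)

theorem finrank_sliceSpace_le :
    Module.finrank ℂ (sliceSpace p lam) ≤ (slice p lam).natDegree := by
  obtain ⟨k, hk⟩ := exists_kernels hball
  rw [sliceSpace_eq_span_range h0 hk]
  refine (finrank_range_le_card k).trans ?_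
  rw [Fintype.card_sigma, ← Polynomial.splits_iff_card_roots.1 (IsAlgClosed.splits (slice p lam)),
    ← Multiset.toFinset_sum_count_eq]
  simp only [Fintype.card_fin, Polynomial.count_roots]
  rw [Finset.sum_coe_sort (slice p lam).roots.toFinset
    fun μ => (slice p lam).rootMultiplicity μ]

/-- Polynomials in the last variable of degree below that of the slice project injectively to
`sliceSpace p lam`: one projecting to zero is annihilated by all derivative kernels, hence divisible
by the slice. Linear independence of the kernels is not needed. -/
theorem le_finrank_sliceSpace :
    (slice p lam).natDegree ≤ Module.finrank ℂ (sliceSpace p lam) := by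
  have := finiteDimensional_sliceSpace h0 hball
  let ι : Polynomial.degreeLT ℂ (slice p lam).natDegree →ₗ[ℂ] sliceSpace p lam :=
    (sliceSpace p lam).orthogonalProjectionOnto.toLinearMap ∘ₗ ofPoly ∘ₗ
      (Polynomial.aeval (MvPolynomial.X (Fin.last m) :
        MvPolynomial (Fin (m + 1)) ℂ)).toLinearMap ∘ₗ Submodule.subtype _
  have hι : Function.Injective ι := by
    rw [← LinearMap.ker_eq_bot, LinearMap.ker_eq_bot']
    rintro ⟨g, hg⟩ hz
    have hz' : (sliceSpace p lam).orthogonalProjectionOnto (ofPoly (Polynomial.aeval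
        (MvPolynomial.X (Fin.last m) : MvPolynomial (Fin (m + 1)) ℂ) g)) = 0 := hz
    rw [Submodule.orthogonalProjectionOnto_eq_zero_iff, Submodule.mem_orthogonal] at hz'
    have hdvd : slice p lam ∣ g := by
      rw [dvd_iff_derivative_eval h0]
      intro μ l hl
      have hμ : μ ∈ (slice p lam).roots := by
        rw [Polynomial.mem_roots h0, ← Polynomial.rootMultiplicity_pos h0]
        exact (Nat.zero_le _).trans_lt hl
      obtain ⟨k, hk⟩ := exists_isDerivKernel (hball μ hμ) l
      rw [← slice_aeval_X_last g lam, ← hk.inner_ofPoly]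
      exact hz' k (hk.mem_sliceSpace h0 hl)
    refine Subtype.ext (Polynomial.eq_zero_of_dvd_of_degree_lt hdvd ?_)
    rw [Polynomial.degree_eq_natDegree h0]
    exact Polynomial.mem_degreeLT.1 hg
  have := LinearMap.finrank_le_finrank_of_injective hι
  rwa [(Polynomial.degreeLTEquiv ℂ _).finrank_eq, Module.finrank_fin_fun] at this

end Kernels

end DruryArveson

/-! ### Closed range of a column of adjoints -/

section ClosedRange

variable {E : Type*} [NormedAddCommGroup E] [InnerProductSpace ℂ E] [CompleteSpace E] {m : ℕ}

/-- If the ranges of `T_1, …, T_m` together span a subspace of finite codimension, then the column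
of the adjoints has closed range. -/
theorem isClosed_range_adjoint_column (T : Fin m → E →L[ℂ] E) (F : Submodule ℂ E)
    [FiniteDimensional ℂ F] (hF : (⨆ j, LinearMap.range (T j : E →ₗ[ℂ] E)) ⊔ F = ⊤) :
    IsClosed (Set.range fun (h : E) (j : Fin m) => ContinuousLinearMap.adjoint (T j) h) := by
  let R : (Fin m → E) →L[ℂ] E := ∑ j, T j ∘L ContinuousLinearMap.proj j
  have hR : ∀ y, R y = ∑ j, T j (y j) := fun y => by
    simp [R]
  let C : E →L[ℂ] (Fin m → E) := ContinuousLinearMap.pi fun j => ContinuousLinearMap.adjoint (T j)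
  have hle : ∀ j x, T j x ∈ R.range := fun j x => ⟨Pi.single j x, by
    rw [ContinuousLinearMap.coe_coe, hR, Finset.sum_eq_single j]
    · simp
    · intro i _ hi
      simp [hi]
    · simp⟩
  have hsup : R.range ⊔ F = ⊤ := by
    rw [eq_top_iff, ← hF]
    refine sup_le_sup_right (iSup_le fun j => ?_) F
    rintro _ ⟨x, rfl⟩
    exact hle j x
  have hclosed : IsClosed (R.range : Set E) := by
    let u : ((Fin m → E) × F) →L[ℂ] E := R ∘L ContinuousLinearMap.fst ℂ _ _
    let v : ((Fin m → E) × F) →L[ℂ] E :=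
      R ∘L ContinuousLinearMap.fst ℂ _ _ + F.subtypeL ∘L ContinuousLinearMap.snd ℂ _ _
    have hv : Function.Surjective v := by
      intro x
      obtain ⟨_, ⟨y, rfl⟩, f, hf, hx⟩ :=
        Submodule.mem_sup.1 (hsup ▸ Submodule.mem_top : x ∈ R.range ⊔ F)
      exact ⟨(y, ⟨f, hf⟩), hx⟩
    have hA : (LinearMap.ker (LinearMap.snd ℂ (Fin m → E) F)).CoFG := Submodule.CoFG.ker _
    -- `u` and the surjection `v` agree on a subspace of finite codimension, so `u` inherits
    -- strictness and closed range from `v`.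
    have huv := ContinuousLinearMap.isStrictMap_isClosed_range_iff_of_eqOn u v
      (LinearMap.ker (LinearMap.snd ℂ (Fin m → E) F)) fun x hx => by
        have : x.2 = 0 := hx
        simp [u, v, this]
    have hu := huv.2 ⟨(v.isOpenMap hv).isStrictMap v.continuous, by
      rw [LinearMap.range_eq_top.2 hv]
      exact isClosed_univ⟩
    have hrange : u.range = R.range := by
      ext x
      constructor
      · rintro ⟨y, rfl⟩
        exact ⟨y.1, rfl⟩
      · rintro ⟨y, rfl⟩
        exact ⟨(y, 0), rfl⟩
    exact hrange ▸ hu.2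
  have : CompleteSpace R.range := hclosed.completeSpace_coe
  obtain ⟨M, hM, hpre⟩ := ContinuousLinearMap.exists_preimage_norm_le
    (R.codRestrict R.range fun y => ⟨y, rfl⟩) (by
      rintro ⟨_, ⟨y, rfl⟩⟩
      exact ⟨y, rfl⟩)
  -- With `R y = h` and `‖y‖ ≤ M * ‖h‖` from the open mapping theorem, `‖h‖ ^ 2 = ∑ ⟨y_j, T_j^* h⟩`;
  -- the factor `m` comes from the sup norm on `Fin m → E`.
  have hbound : ∀ h : R.range, ‖h‖ ≤ (m * M) * ‖C h‖ := by
    intro h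
    obtain ⟨y, hy, hyM⟩ := hpre h
    have hy' : R y = h := congrArg Subtype.val hy
    have h1 : ‖h‖ ^ 2 ≤ (m * M * ‖C h‖) * ‖h‖ := by
      have h2 : ((‖h‖ : ℂ)) ^ 2 = ∑ j, inner ℂ (y j) (C h j) := by
        refine (inner_self_eq_norm_sq_to_K (𝕜 := ℂ) (h : E)).symm.trans ?_
        nth_rewrite 1 [← hy']
        rw [hR, sum_inner]
        refine Finset.sum_congr rfl fun j _ => ?_
        exact (ContinuousLinearMap.adjoint_inner_right _ _ _).symm
      have h3 : ‖h‖ ^ 2 = ‖∑ j, inner ℂ (y j) (C h j)‖ := by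
        rw [← h2, norm_pow, Complex.norm_real, norm_norm]
      rw [h3]
      calc _ ≤ ∑ j : Fin m, ‖inner ℂ (y j) (C h j)‖ := norm_sum_le _ _
        _ ≤ ∑ _j : Fin m, (M * ‖h‖) * ‖C h‖ := Finset.sum_le_sum fun j _ =>
            (norm_inner_le_norm _ _).trans
              (mul_le_mul ((norm_le_pi_norm y j).trans hyM) (norm_le_pi_norm (C h) j)
                (norm_nonneg _) (by positivity))
        _ = _ := by
            rw [Finset.sum_const, Finset.card_univ, Fintype.card_fin, nsmul_eq_mul]
            ring
    rcases (norm_nonneg h).eq_or_lt with h0 | h0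
    · rw [← h0]
      positivity
    · rw [sq] at h1
      exact le_of_mul_le_mul_right h1 h0
  have hanti := ContinuousLinearMap.antilipschitz_of_bound (C ∘L R.range.subtypeL)
    (K := ⟨m * M, by positivity⟩) hbound
  have hcl := hanti.isClosed_range (C ∘L R.range.subtypeL).uniformContinuous
  -- `C` vanishes on the orthogonal complement of the range of `R`, so restricting it to that range
  -- does not shrink its image.
  suffices heq : (Set.range fun (h : E) (j : Fin m) => ContinuousLinearMap.adjoint (T j) h) =
      Set.range (C ∘L R.range.subtypeL) from heq ▸ hcl
  refine Set.Subset.antisymm ?_ ?_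
  · rintro _ ⟨h, rfl⟩
    refine ⟨R.range.orthogonalProjectionOnto h, ?_⟩
    funext j
    change ContinuousLinearMap.adjoint (T j) _ = ContinuousLinearMap.adjoint (T j) h
    have hperp := Submodule.sub_starProjection_mem_orthogonal (K := R.range) h
    rw [Submodule.mem_orthogonal] at hperp
    have : ContinuousLinearMap.adjoint (T j) (h - R.range.starProjection h) = 0 := by
      refine ext_inner_left ℂ fun x => ?_
      rw [ContinuousLinearMap.adjoint_inner_right, inner_zero_right]
      exact hperp _ (hle j x)
    rw [map_sub, sub_eq_zero] at this
    exact this.symm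
  · rintro _ ⟨h, rfl⟩
    exact ⟨h, rfl⟩

end ClosedRange

namespace DruryArveson

variable {d m n : ℕ}

/-! ### Division by `z - w` and finite codimension -/

theorem weight_add_single (j : Fin d) (α : Fin d →₀ ℕ) :
    weight (α + Finsupp.single j 1) * ((∑ i, α i) + 1 : ℕ) = weight α * (α j + 1 : ℕ) := by
  have h1 : ∑ i, (α + Finsupp.single j 1 : Fin d →₀ ℕ) i = (∑ i, α i) + 1 := by
    simp [Finset.sum_add_distrib, Finsupp.single_apply]
  have h2 : ∏ i, ((α + Finsupp.single j 1 : Fin d →₀ ℕ) i)! = (α j + 1) * ∏ i, (α i)! := by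
    rw [← Finset.mul_prod_erase _ _ (Finset.mem_univ j),
      ← Finset.mul_prod_erase (f := fun i => (α i)!) _ (Finset.mem_univ j), ← mul_assoc]
    congr 1
    · simp [Nat.factorial_succ]
    · refine Finset.prod_congr rfl fun i hi => ?_
      have : j ≠ i := (Finset.ne_of_mem_erase hi).symm
      simp [this]
  unfold weight
  rw [h1, h2, Nat.factorial_succ]
  have h4 : (((∑ i, α i)! : ℕ) : ℝ) ≠ 0 := by exact_mod_cast Nat.factorial_ne_zero _
  have h5 : (((∑ i, α i) + 1 : ℕ) : ℝ) ≠ 0 := Nat.cast_ne_zero.2 (Nat.succ_ne_zero _)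
  rw [Nat.cast_mul, Nat.cast_mul]
  field_simp

theorem mulCoord_single (j : Fin d) (α : Fin d →₀ ℕ) :
    mulCoord j (lp.single 2 α 1) = lp.single 2 (α + Finsupp.single j 1)
      ((Real.sqrt (weight (α + Finsupp.single j 1)) : ℂ) / (Real.sqrt (weight α) : ℂ)) := by
  have h : (lp.single 2 α 1 : H2 d) =
      ofPoly (MvPolynomial.monomial α (1 / (Real.sqrt (weight α) : ℂ))) := by
    rw [ofPoly_monomial, mul_one_div_cancel (sqrt_weight_ne_zero α)]
  rw [h, ← polyOp_X, polyOp_ofPoly, MvPolynomial.X, MvPolynomial.monomial_mul, one_mul, add_comm,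
    ofPoly_monomial, mul_one_div]

theorem adjoint_mulCoord_apply (j : Fin d) (f : H2 d) (α : Fin d →₀ ℕ) :
    ContinuousLinearMap.adjoint (mulCoord j) f α =
      (Real.sqrt (weight (α + Finsupp.single j 1)) : ℂ) / (Real.sqrt (weight α) : ℂ) *
        f (α + Finsupp.single j 1) := by
  have h := lp.inner_single_left (𝕜 := ℂ) α (1 : ℂ) (ContinuousLinearMap.adjoint (mulCoord j) f)
  rw [ContinuousLinearMap.adjoint_inner_right, mulCoord_single, lp.inner_single_left] at h
  simp only [RCLike.inner_apply, map_one, mul_one, map_div₀] at h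
  rw [← h]
  erw [Complex.conj_ofReal, Complex.conj_ofReal]
  ring

/-- `M_j M_j^*` is diagonal in the monomial basis. At `β = 0` the quotient is `0 / 0 = 0`, which is
the correct eigenvalue; elsewhere the eigenvalues add up to `1` over `j`. -/
theorem mulCoord_adjoint_apply (j : Fin d) (f : H2 d) (β : Fin d →₀ ℕ) :
    mulCoord j (ContinuousLinearMap.adjoint (mulCoord j) f) β =
      ((β j : ℂ) / (∑ i, β i : ℕ)) * f β := by
  change shiftFun j _ β = _
  by_cases hj : β j = 0
  · simp [shiftFun, hj]
  · obtain ⟨α, rfl⟩ : ∃ α, β = α + Finsupp.single j 1 :=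
      ⟨β - Finsupp.single j 1, (tsub_add_cancel_of_le
        (Finsupp.single_le_iff.2 (Nat.one_le_iff_ne_zero.2 hj))).symm⟩
    rw [shiftFun_add_single, coeff_def, adjoint_mulCoord_apply]
    have h1 : ∑ i, (α + Finsupp.single j 1 : Fin d →₀ ℕ) i = (∑ i, α i) + 1 := by
      simp [Finset.sum_add_distrib, Finsupp.single_apply]
    have h2 : (α + Finsupp.single j 1 : Fin d →₀ ℕ) j = α j + 1 := by simp
    rw [h1, h2]
    have hw : (weight (α + Finsupp.single j 1) : ℂ) * ((∑ i, α i) + 1 : ℕ) =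
        weight α * (α j + 1 : ℕ) := by exact_mod_cast weight_add_single j α
    have hs : ∀ γ : Fin d →₀ ℕ, (Real.sqrt (weight γ) : ℂ) * (Real.sqrt (weight γ) : ℂ) =
        weight γ := fun γ => by exact_mod_cast Real.mul_self_sqrt (weight_pos γ).le
    have h0 := sqrt_weight_ne_zero α
    have h5 : (((∑ i, α i) + 1 : ℕ) : ℂ) ≠ 0 := Nat.cast_ne_zero.2 (Nat.succ_ne_zero _)
    rw [← hs, ← hs] at hw
    rw [← mul_div_assoc, ← mul_assoc, mul_div_right_comm]
    congr 1
    rw [← mul_div_assoc, div_div, div_eq_div_iff (mul_ne_zero h0 h0) h5, hw]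
    ring

/-- `∑_j M_j M_j^*` is the projection onto the functions vanishing at the origin. -/
theorem sum_mulCoord_adjoint (f : H2 d) :
    ∑ j, mulCoord j (ContinuousLinearMap.adjoint (mulCoord j) f) = f - f 0 • one := by
  classical
  ext β
  rw [lp.coeFn_sum, Finset.sum_apply]
  simp only [mulCoord_adjoint_apply]
  rw [← Finset.sum_mul, ← Finset.sum_div]
  change _ = f β - f 0 * (one : H2 d) β
  rw [one, lp.single_apply]
  by_cases hβ : β = 0
  · subst hβ
    simp
  · rw [← Nat.cast_sum, div_self, one_mul]
    · simp [hβ]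
    · rw [Nat.cast_ne_zero]
      intro h
      rw [Finset.sum_eq_zero_iff] at h
      exact hβ (Finsupp.ext fun i => h i (Finset.mem_univ i))

theorem sum_norm_adjoint_sq_le (f : H2 d) :
    ∑ j, ‖ContinuousLinearMap.adjoint (mulCoord j) f‖ ^ 2 ≤ ‖f‖ ^ 2 := by
  have h1 : inner ℂ f (∑ j, mulCoord j (ContinuousLinearMap.adjoint (mulCoord j) f)) =
      ((∑ j, ‖ContinuousLinearMap.adjoint (mulCoord j) f‖ ^ 2 : ℝ) : ℂ) := by
    rw [inner_sum, Complex.ofReal_sum]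
    refine Finset.sum_congr rfl fun j _ => ?_
    rw [← ContinuousLinearMap.adjoint_inner_left, inner_self_eq_norm_sq_to_K]
    simp
  have h2 : inner ℂ f (f - f 0 • one) = ((‖f‖ ^ 2 - ‖f 0‖ ^ 2 : ℝ) : ℂ) := by
    rw [inner_sub_right, inner_smul_right, one, lp.inner_single_right, inner_self_eq_norm_sq_to_K]
    simp only [RCLike.inner_apply, one_mul, Complex.mul_conj]
    rw [Complex.normSq_eq_norm_sq]
    simp
  rw [sum_mulCoord_adjoint, h2] at h1
  have h3 := Complex.ofReal_injective h1
  rw [← h3]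
  have := sq_nonneg ‖f 0‖
  linarith

/-- Functions on the ball can be divided by `z - w` up to a constant, for `w` in the ball. -/
theorem exists_eq_sum_sub {w : EuclideanSpace ℂ (Fin d)} (hw : ‖w‖ < 1) (f : H2 d) :
    ∃ (g : Fin d → H2 d) (c : ℂ), f = ∑ j, (mulCoord j (g j) - w j • g j) + c • one := by
  let A : H2 d →L[ℂ] H2 d := ∑ j, w j • ContinuousLinearMap.adjoint (mulCoord j)
  have hA : ∀ f, A f = ∑ j, w j • ContinuousLinearMap.adjoint (mulCoord j) f := fun f => by
    simp [A]
  have hnorm : ‖A‖ < 1 := by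
    refine (ContinuousLinearMap.opNorm_le_bound _ (norm_nonneg w) fun f => ?_).trans_lt hw
    rw [hA]
    calc _ ≤ ∑ j, ‖w j‖ * ‖ContinuousLinearMap.adjoint (mulCoord j) f‖ :=
          (norm_sum_le _ _).trans_eq (Finset.sum_congr rfl fun j _ => norm_smul _ _)
      _ ≤ √(∑ j, ‖w j‖ ^ 2) * √(∑ j, ‖ContinuousLinearMap.adjoint (mulCoord j) f‖ ^ 2) :=
          Real.sum_mul_le_sqrt_mul_sqrt _ _ _
      _ ≤ ‖w‖ * ‖f‖ := by
          rw [← EuclideanSpace.norm_eq]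
          gcongr
          exact Real.sqrt_le_iff.2 ⟨norm_nonneg _, sum_norm_adjoint_sq_le f⟩
  -- By the Neumann series the given function is `(1 - A) f`, and `1 - A` equals `∑ (M_j - w_j)
  -- M_j^*` plus the projection onto constants.
  obtain ⟨f, rfl⟩ := (ContinuousLinearMap.isUnit_iff_bijective.1
    (isUnit_one_sub_of_norm_lt_one hnorm)).2 f
  refine ⟨fun j => ContinuousLinearMap.adjoint (mulCoord j) f, f 0, ?_⟩
  rw [Finset.sum_sub_distrib, sum_mulCoord_adjoint, ← hA]
  change f - A f = _
  abel

/-- The subspace `∑_{j < d} (z_j - lam_j) H²_d + p H²_d`. -/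
def sliceRange (p : MvPolynomial (Fin (m + 1)) ℂ) (lam : EuclideanSpace ℂ (Fin m)) :
    Submodule ℂ (H2 (m + 1)) :=
  (⨆ j : Fin m, LinearMap.range (polyOp (MvPolynomial.X j.castSucc - MvPolynomial.C (lam j)))) ⊔
    LinearMap.range (polyOp p)

theorem polyOp_comm (p q : MvPolynomial (Fin d) ℂ) (f : H2 d) :
    polyOp p (polyOp q f) = polyOp q (polyOp p f) := by
  rw [← Module.End.mul_apply, ← map_mul, mul_comm, map_mul, Module.End.mul_apply]

theorem map_polyOp_range_le (p q : MvPolynomial (Fin d) ℂ) :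
    (LinearMap.range (polyOp p)).map (polyOp q) ≤ LinearMap.range (polyOp p) := by
  rintro _ ⟨_, ⟨f, rfl⟩, rfl⟩
  exact ⟨polyOp q f, polyOp_comm p q f⟩

theorem map_polyOp_sliceRange_le (p q : MvPolynomial (Fin (m + 1)) ℂ)
    (lam : EuclideanSpace ℂ (Fin m)) :
    (sliceRange p lam).map (polyOp q) ≤ sliceRange p lam := by
  rw [sliceRange, Submodule.map_sup, Submodule.map_iSup]
  exact sup_le_sup (iSup_mono fun j => map_polyOp_range_le _ _) (map_polyOp_range_le _ _)

theorem polyOp_mem_sliceRange {p q : MvPolynomial (Fin (m + 1)) ℂ}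
    {lam : EuclideanSpace ℂ (Fin m)} (h : slice p lam ∣ slice q lam) (f : H2 (m + 1)) :
    polyOp q f ∈ sliceRange p lam := by
  have hle : Ideal.span (insert p (Set.range fun j : Fin m =>
      MvPolynomial.X j.castSucc - MvPolynomial.C (lam j))) ≤
      { carrier := {q | ∀ f, polyOp q f ∈ sliceRange p lam}
        add_mem' := fun {a b} ha hb f => by
          rw [map_add, LinearMap.add_apply]
          exact add_mem (ha f) (hb f)
        zero_mem' := fun f => by simp
        smul_mem' := fun c a ha f => by
          rw [smul_eq_mul, mul_comm, map_mul]
          exact ha _ } := by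
    rw [Ideal.span_le, Set.insert_subset_iff]
    refine ⟨fun f => Submodule.mem_sup_right ⟨f, rfl⟩, ?_⟩
    rintro _ ⟨j, rfl⟩ f
    exact Submodule.mem_sup_left (Submodule.mem_iSup_of_mem j ⟨f, rfl⟩)
  exact hle ((slice_dvd_iff p q lam).1 h) f

theorem sliceRange_sup_linear (p : MvPolynomial (Fin (m + 1)) ℂ)
    {lam : EuclideanSpace ℂ (Fin m)} {μ : ℂ} (h : ‖point lam μ‖ < 1) :
    sliceRange p lam ⊔ LinearMap.range (polyOp (MvPolynomial.X (Fin.last m) - MvPolynomial.C μ)) ⊔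
      Submodule.span ℂ {one} = ⊤ := by
  rw [eq_top_iff]
  rintro f -
  obtain ⟨g, c, rfl⟩ := exists_eq_sum_sub h f
  refine add_mem (Submodule.mem_sup_left ?_)
    (Submodule.mem_sup_right (Submodule.smul_mem _ _ (Submodule.mem_span_singleton_self _)))
  rw [Fin.sum_univ_castSucc]
  refine add_mem (Submodule.mem_sup_left (Submodule.mem_sup_left (sum_mem fun j _ => ?_)))
    (Submodule.mem_sup_right ⟨g (Fin.last m), ?_⟩)
  · refine Submodule.mem_iSup_of_mem j ⟨g j.castSucc, ?_⟩
    rw [polyOp_X_sub_C]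
    simp [point]
  · rw [polyOp_X_sub_C]
    simp [point]

/-- Each linear factor costs at most one dimension: multiplying the decomposition at `(lam, μ)` by
the product `Q` of the earlier factors adds only the vector `Q · 1`. -/
theorem exists_sliceRange_sup_prod (p : MvPolynomial (Fin (m + 1)) ℂ)
    {lam : EuclideanSpace ℂ (Fin m)} (s : Multiset ℂ) (hs : ∀ μ ∈ s, ‖point lam μ‖ < 1) :
    ∃ F : Submodule ℂ (H2 (m + 1)), FiniteDimensional ℂ F ∧
      sliceRange p lam ⊔ LinearMap.range (polyOp (s.map fun μ =>
        (MvPolynomial.X (Fin.last m) - MvPolynomial.C μ :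
          MvPolynomial (Fin (m + 1)) ℂ)).prod) ⊔ F = ⊤ := by
  induction s using Multiset.induction_on with
  | empty =>
    refine ⟨⊥, inferInstance, ?_⟩
    rw [Multiset.map_zero, Multiset.prod_zero, map_one, Module.End.one_eq_id, LinearMap.range_id]
    simp
  | cons μ s ih =>
    obtain ⟨F, hF, htop⟩ := ih fun ν hν => hs ν (Multiset.mem_cons_of_mem hν)
    set Q := (s.map fun μ => (MvPolynomial.X (Fin.last m) - MvPolynomial.C μ :
          MvPolynomial (Fin (m + 1)) ℂ)).prod with hQ
    refine ⟨F ⊔ (Submodule.span ℂ {one}).map (polyOp Q), inferInstance, ?_⟩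
    rw [Multiset.map_cons, Multiset.prod_cons, ← hQ, eq_top_iff, ← htop]
    have hrange : LinearMap.range (polyOp Q) ≤ sliceRange p lam ⊔
        LinearMap.range (polyOp ((MvPolynomial.X (Fin.last m) - MvPolynomial.C μ) * Q)) ⊔
          (Submodule.span ℂ {one}).map (polyOp Q) := by
      rw [LinearMap.range_eq_map, ← sliceRange_sup_linear p (hs μ (Multiset.mem_cons_self μ s)),
        Submodule.map_sup, Submodule.map_sup]
      refine sup_le_sup_right (sup_le_sup (map_polyOp_sliceRange_le _ _ _) ?_) _
      rintro _ ⟨_, ⟨f, rfl⟩, rfl⟩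
      refine ⟨f, ?_⟩
      rw [mul_comm, map_mul, Module.End.mul_apply]
    refine sup_le (sup_le ?_ (hrange.trans ?_)) ?_
    · exact le_sup_of_le_left le_sup_left
    · exact sup_le_sup_left le_sup_right _
    · exact le_sup_of_le_right le_sup_left

/-- If all roots of the slice of `p` lie in the ball, then `sliceRange p lam` has finite
codimension. -/
theorem exists_sliceRange_sup_eq_top {p : MvPolynomial (Fin (m + 1)) ℂ}
    {lam : EuclideanSpace ℂ (Fin m)} (h0 : slice p lam ≠ 0)
    (hball : ∀ μ ∈ (slice p lam).roots, ‖point lam μ‖ < 1) :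
    ∃ F : Submodule ℂ (H2 (m + 1)), FiniteDimensional ℂ F ∧ sliceRange p lam ⊔ F = ⊤ := by
  obtain ⟨F, hF, htop⟩ := exists_sliceRange_sup_prod p _ hball
  refine ⟨F, hF, ?_⟩
  rwa [sup_eq_left (a := sliceRange p lam) |>.2] at htop
  rintro _ ⟨f, rfl⟩
  refine polyOp_mem_sliceRange ?_ f
  -- The product over all roots has the slice of `p` as its own slice, up to the leading
  -- coefficient, so its range is absorbed by `sliceRange p lam`.
  have hprod : slice ((slice p lam).roots.map fun μ =>
      (MvPolynomial.X (Fin.last m) - MvPolynomial.C μ : MvPolynomial (Fin (m + 1)) ℂ)).prod lam =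
      ((slice p lam).roots.map fun μ => Polynomial.X - Polynomial.C μ).prod := by
    rw [slice_eq _ lam, map_multiset_prod, Multiset.map_map]
    congr 1
    refine Multiset.map_congr rfl fun μ _ => ?_
    rw [Function.comp_apply, map_sub, sliceHom_X_last, sliceHom_C]
    rfl
  rw [hprod, (IsAlgClosed.splits (slice p lam)).eq_prod_roots, Polynomial.roots_C_mul _
    (Polynomial.leadingCoeff_ne_zero.2 h0), Polynomial.roots_multiset_prod_X_sub_C]
  refine (IsUnit.mul_left_dvd ?_).2 dvd_rfl
  rw [Polynomial.isUnit_C, isUnit_iff_ne_zero]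
  exact Polynomial.leadingCoeff_ne_zero.2 h0

/-! ### Closed range for the compressed tuple -/

theorem projection_mulCoord (p : MvPolynomial (Fin d) ℂ) (j : Fin d) (f : H2 d) :
    (Hp p).orthogonalProjectionOnto (mulCoord j f) =
      compressedShift p j ((Hp p).orthogonalProjectionOnto f) := by
  refine ext_inner_left ℂ fun y => ?_
  rw [Submodule.inner_orthogonalProjectionOnto_eq_of_mem_left,
    ← ContinuousLinearMap.adjoint_inner_left, ← coe_adjoint_compressedShift,
    ← Submodule.inner_orthogonalProjectionOnto_eq_of_mem_left,
    ContinuousLinearMap.adjoint_inner_left]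

theorem isClosed_range_adjointTuple {p : MvPolynomial (Fin (m + 1)) ℂ}
    {lam : EuclideanSpace ℂ (Fin m)} (h0 : slice p lam ≠ 0)
    (hball : ∀ μ ∈ (slice p lam).roots, ‖point lam μ‖ < 1) :
    IsClosed (Set.range fun (h : Hp p) (j : Fin m) =>
      adjointTuple p j h - conj (lam j) • h) := by
  obtain ⟨F, hF, htop⟩ := exists_sliceRange_sup_eq_top h0 hball
  let P : H2 (m + 1) →ₗ[ℂ] Hp p := (Hp p).orthogonalProjectionOnto.toLinearMap
  let T : Fin m → Hp p →L[ℂ] Hp p := fun j =>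
    compressedShift p j.castSucc - lam j • ContinuousLinearMap.id ℂ (Hp p)
  have hT : ∀ j h, ContinuousLinearMap.adjoint (T j) h =
      adjointTuple p j h - conj (lam j) • h := by
    intro j h
    refine ext_inner_right ℂ fun y => ?_
    rw [ContinuousLinearMap.adjoint_inner_left]
    change inner ℂ h (compressedShift p j.castSucc y - lam j • y) = _
    rw [inner_sub_right, inner_sub_left, inner_smul_right, inner_smul_left, adjointTuple,
      ContinuousLinearMap.adjoint_inner_left, Complex.conj_conj]
  -- Project the finite codimension statement to `Hp p`: `p H²` is killed and `(z_j - lam_j) H²`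
  -- lands in the range of `S_j - lam_j`.
  have hsup : (⨆ j, LinearMap.range (T j : Hp p →ₗ[ℂ] Hp p)) ⊔ F.map P = ⊤ := by
    have hP : LinearMap.range P = ⊤ := by
      refine LinearMap.range_eq_top.2 fun h => ⟨h, ?_⟩
      exact Submodule.orthogonalProjectionOnto_mem_subspace_eq_self h
    rw [eq_top_iff, ← hP, LinearMap.range_eq_map, ← htop, Submodule.map_sup, sliceRange,
      Submodule.map_sup, Submodule.map_iSup]
    refine sup_le_sup_right (sup_le (iSup_mono fun j => ?_) ?_) _
    · rintro _ ⟨_, ⟨f, rfl⟩, rfl⟩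
      refine ⟨P f, ?_⟩
      rw [polyOp_X_sub_C, map_sub, map_smul]
      change _ = (Hp p).orthogonalProjectionOnto (mulCoord j.castSucc f) - _
      rw [projection_mulCoord]
      rfl
    · rintro _ ⟨_, ⟨f, rfl⟩, rfl⟩
      have : P (polyOp p f) = 0 := by
        refine Submodule.orthogonalProjectionOnto_eq_zero_iff.2 ?_
        exact Submodule.le_orthogonal_orthogonal _ (mem_polyMul.2 ⟨f, rfl⟩)
      rw [this]
      exact zero_mem _
  have := isClosed_range_adjoint_column T (F.map P) hsup
  simpa only [hT] using this

/-- The homogeneous component of degree `j` of the power series of `f`. -/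
def homPart (f : H2 d) (j : ℕ) : MvPolynomial (Fin d) ℂ :=
  ∑ α ∈ Finset.univ.finsuppAntidiag j, MvPolynomial.monomial α (coeff f α)

/-! ### Homogeneous components and scaling -/

theorem homPart_isHomogeneous (f : H2 d) (j : ℕ) : (homPart f j).IsHomogeneous j := by
  refine MvPolynomial.IsHomogeneous.sum _ _ _ fun α hα => ?_
  refine MvPolynomial.isHomogeneous_monomial _ ?_
  rw [Finsupp.degree_eq_sum]
  exact (Finset.mem_finsuppAntidiag.1 hα).1

theorem hasSum_inner_homPart (k f : H2 d) :
    HasSum (fun j => inner ℂ k (ofPoly (homPart f j))) (inner ℂ k f) := by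
  have h := (innerSL ℂ k).hasSum (hasSum_ofPoly_monomial f)
  have h' := h.tsum_fiberwise fun α => ∑ i, α i
  refine h'.congr_fun fun j => ?_
  have hset : (fun α : Fin d →₀ ℕ => ∑ i, α i) ⁻¹' {j} =
      ((Finset.univ.finsuppAntidiag j : Finset (Fin d →₀ ℕ)) : Set (Fin d →₀ ℕ)) := by
    ext α
    simp [Finset.mem_finsuppAntidiag]
  rw [hset, homPart, map_sum, inner_sum]
  exact (Finset.tsum_subtype' (Finset.univ.finsuppAntidiag j) fun α =>
    inner ℂ k (ofPoly (MvPolynomial.monomial α (coeff f α)))).symm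

theorem eval_smul_of_isHomogeneous {q : MvPolynomial (Fin d) ℂ} (hq : q.IsHomogeneous n) (s : ℂ)
    (z : Fin d → ℂ) : MvPolynomial.eval (s • z) q = s ^ n * MvPolynomial.eval z q := by
  rw [MvPolynomial.eval_eq', MvPolynomial.eval_eq', Finset.mul_sum]
  refine Finset.sum_congr rfl fun α hα => ?_
  have : ∏ i, (s • z) i ^ α i = s ^ n * ∏ i, z i ^ α i := by
    simp only [Pi.smul_apply, smul_eq_mul, mul_pow, Finset.prod_mul_distrib]
    rw [Finset.prod_pow_eq_pow_sum, sum_eq_of_mem_support hq hα]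
  rw [this]
  ring

theorem eval_point_smul {q : MvPolynomial (Fin (m + 1)) ℂ} (hq : q.IsHomogeneous n) (s : ℂ)
    (lam : EuclideanSpace ℂ (Fin m)) (t : ℂ) :
    MvPolynomial.eval (point (s • lam) (s * t)) q = s ^ n * MvPolynomial.eval (point lam t) q := by
  rw [← eval_smul_of_isHomogeneous hq]
  congr 2
  funext i
  refine Fin.lastCases ?_ (fun i => ?_) i
  · simp [point]
  · simp [point]

theorem iterate_derivative_comp_C_mul_X (P : Polynomial ℂ) (s : ℂ) (l : ℕ) :
    Polynomial.derivative^[l] (P.comp (Polynomial.C s * Polynomial.X)) =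
      Polynomial.C (s ^ l) * (Polynomial.derivative^[l] P).comp (Polynomial.C s * Polynomial.X) := by
  induction l with
  | zero => simp
  | succ l ih =>
    rw [Function.iterate_succ_apply', ih, Function.iterate_succ_apply', Polynomial.derivative_mul,
      Polynomial.derivative_comp]
    simp only [Polynomial.derivative_C, Polynomial.derivative_mul, Polynomial.derivative_X, map_pow,
      pow_succ]
    rw [← map_pow, Polynomial.derivative_C]
    simp only [map_mul, map_pow]
    ring

/-- Differentiate `q (s lam, s t) = s ^ n q (lam, t)` in `t`, `l` times, by the chain rule. -/
theorem derivative_slice_smul {q : MvPolynomial (Fin (m + 1)) ℂ} (hq : q.IsHomogeneous n) (s : ℂ)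
    (lam : EuclideanSpace ℂ (Fin m)) (μ : ℂ) (l : ℕ) :
    s ^ l * (Polynomial.derivative^[l] (slice q (s • lam))).eval (s * μ) =
      s ^ n * (Polynomial.derivative^[l] (slice q lam)).eval μ := by
  have h : (slice q (s • lam)).comp (Polynomial.C s * Polynomial.X) =
      Polynomial.C (s ^ n) * slice q lam := by
    refine Polynomial.funext fun t => ?_
    rw [Polynomial.eval_comp, Polynomial.eval_C_mul, Polynomial.eval_C_mul, Polynomial.eval_X,
      eval_slice, eval_slice, eval_point_smul hq]
  have h' := congrArg (fun P => (Polynomial.derivative^[l] P).eval μ) h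
  simp only [iterate_derivative_comp_C_mul_X, Polynomial.iterate_derivative_C_mul,
    Polynomial.eval_mul, Polynomial.eval_C, Polynomial.eval_comp, Polynomial.eval_X] at h'
  exact h'

/-- A power series vanishing on a punctured disc has vanishing coefficients. -/
theorem eq_zero_of_hasSum_pow_mul {a : ℕ → ℂ}
    (h : ∀ s : ℂ, s ≠ 0 → ‖s‖ < 1 → HasSum (fun j => s ^ j * a j) 0) : a = 0 := by
  -- The series is multiplied by `s`, shifting the indices by one, so that it also vanishes at `s =
  -- 0`, where nothing is assumed.
  let b : ℕ → ℂ := fun j => Nat.casesOn j 0 a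
  have hb : HasFPowerSeriesAt (fun _ : ℂ => (0 : ℂ)) (FormalMultilinearSeries.ofScalars ℂ b) 0 := by
    rw [hasFPowerSeriesAt_iff]
    filter_upwards [Metric.ball_mem_nhds (0 : ℂ) one_pos] with s hs
    simp only [FormalMultilinearSeries.coeff_ofScalars, smul_eq_mul]
    rw [← hasSum_nat_add_iff' 1]
    rcases eq_or_ne s 0 with rfl | hs0
    · simp [b]
    · have := (h s hs0 (mem_ball_zero_iff.1 hs)).mul_left s
      simpa [b, pow_succ, mul_comm, mul_left_comm] using this
  have hz := hb.eq_zero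
  funext j
  have := FormalMultilinearSeries.coeff_ofScalars (𝕜 := ℂ) (p := b) (n := j + 1)
  rw [hz] at this
  simpa [b, FormalMultilinearSeries.coeff] using this.symm

/-! ### Density from homogeneity, and root bounds near the origin -/

section Main

variable {p : MvPolynomial (Fin (m + 1)) ℂ} (hp : p.IsHomogeneous n)
  (hpd : MvPolynomial.eval (Pi.single (Fin.last m) 1) p ≠ 0)

include hp hpd

theorem lt_rootMultiplicity_smul {lam : EuclideanSpace ℂ (Fin m)} {μ : ℂ} {l : ℕ}
    (hl : l < (slice p lam).rootMultiplicity μ) {s : ℂ} (hs : s ≠ 0) :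
    l < (slice p (s • lam)).rootMultiplicity (s * μ) := by
  rw [Polynomial.lt_rootMultiplicity_iff_isRoot_iterate_derivative (slice_ne_zero hp hpd _)]
    at hl ⊢
  intro i hi
  have := derivative_slice_smul hp s lam μ i
  rw [(hl i hi : _ = _), mul_zero, mul_eq_zero] at this
  exact this.resolve_left (pow_ne_zero _ hs)

/-- Pairing `f` with the kernel at `(s lam, s μ)` and multiplying by `s ^ l` gives a power series in
`s` whose `j`-th coefficient is the `l`-th derivative of the `j`-th component at `(lam, μ)`. The
pairing is zero for `0 < |s| < 1`, so every coefficient is. -/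
theorem dvd_homPart {r : ℝ} (hr : 0 < r)
    (hball : ∀ lam ∈ Metric.ball (0 : EuclideanSpace ℂ (Fin m)) r, ∀ μ ∈ (slice p lam).roots,
      ‖point lam μ‖ < 1) {f : H2 (m + 1)}
    (hf : ∀ lam ∈ Metric.ball (0 : EuclideanSpace ℂ (Fin m)) r, ∀ k ∈ sliceSpace p lam,
      inner ℂ k f = 0) (j : ℕ) : p ∣ homPart f j := by
  refine dvd_of_slice_dvd hp hpd hr fun lam hlam => ?_
  rw [dvd_iff_derivative_eval (slice_ne_zero hp hpd _)]
  intro μ l hl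
  refine congrFun (eq_zero_of_hasSum_pow_mul (a := fun j =>
    (Polynomial.derivative^[l] (slice (homPart f j) lam)).eval μ) fun s hs hs1 => ?_) j
  have hl' := lt_rootMultiplicity_smul hp hpd hl hs
  have h0 := slice_ne_zero hp hpd (s • lam)
  have hmem : s • lam ∈ Metric.ball (0 : EuclideanSpace ℂ (Fin m)) r := by
    rw [mem_ball_zero_iff] at hlam ⊢
    rw [norm_smul]
    nlinarith [norm_nonneg lam]
  have hroot : s * μ ∈ (slice p (s • lam)).roots := by
    rw [Polynomial.mem_roots h0, ← Polynomial.rootMultiplicity_pos h0]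
    exact (Nat.zero_le _).trans_lt hl'
  obtain ⟨k, hk⟩ := exists_isDerivKernel (hball _ hmem _ hroot) l
  have hsum := (hasSum_inner_homPart k f).mul_left (s ^ l)
  rw [hf _ hmem k (hk.mem_sliceSpace h0 hl'), mul_zero] at hsum
  refine hsum.congr_fun fun i => ?_
  rw [hk.inner_ofPoly, derivative_slice_smul (homPart_isHomogeneous f i)]

theorem eq_zero_of_orthogonal {r : ℝ} (hr : 0 < r)
    (hball : ∀ lam ∈ Metric.ball (0 : EuclideanSpace ℂ (Fin m)) r, ∀ μ ∈ (slice p lam).roots,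
      ‖point lam μ‖ < 1) {f : H2 (m + 1)} (hfp : f ∈ Hp p)
    (hf : ∀ lam ∈ Metric.ball (0 : EuclideanSpace ℂ (Fin m)) r, ∀ k ∈ sliceSpace p lam,
      inner ℂ k f = 0) : f = 0 := by
  have h := hasSum_inner_homPart f f
  have hz : ∀ j, inner ℂ f (ofPoly (homPart f j)) = 0 := by
    intro j
    obtain ⟨g, hg⟩ := dvd_homPart hp hpd hr hball hf j
    rw [hg, ← polyOp_ofPoly]
    exact (Submodule.mem_orthogonal' _ _).1 hfp _ (mem_polyMul.2 ⟨_, rfl⟩)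
  simp only [hz] at h
  exact inner_self_eq_zero.1 (h.unique hasSum_zero)

/-- Near the origin, all roots of the slices lie in the ball. -/
theorem exists_radius_roots : ∃ r : ℝ, 0 < r ∧ r ≤ 1 ∧
    ∀ lam ∈ Metric.ball (0 : EuclideanSpace ℂ (Fin m)) r, ∀ μ ∈ (slice p lam).roots,
      ‖point lam μ‖ < 1 := by
  have hcont : Continuous fun ν : EuclideanSpace ℂ (Fin m) =>
      MvPolynomial.eval (point ν 1) p := by
    refine (MvPolynomial.continuous_eval p).comp (continuous_pi fun i => ?_)
    refine Fin.lastCases ?_ (fun i => ?_) i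
    · simp only [point, Fin.snoc_last]
      fun_prop
    · simp only [point, Fin.snoc_castSucc]
      fun_prop
  have h0 : MvPolynomial.eval (point (0 : EuclideanSpace ℂ (Fin m)) 1) p ≠ 0 := by
    convert hpd using 3
    funext i
    refine Fin.lastCases ?_ (fun i => ?_) i
    · simp [point]
    · simp [point, Fin.castSucc_ne_last i]
  obtain ⟨δ, hδ, hball⟩ := Metric.eventually_nhds_iff_ball.1 (hcont.continuousAt.eventually_ne h0)
  -- If `|μ| ≥ 1/2`, then `‖lam / μ‖ < δ` and homogeneity gives a forbidden zero `(lam / μ, 1)`.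
  -- Otherwise both coordinates have norm below `1/2`, and `1/4 + 1/4 < 1`.
  refine ⟨min (δ / 2) (1 / 2), by positivity, (min_le_right _ _).trans (by norm_num),
    fun lam hlam μ hμ => ?_⟩
  rw [mem_ball_zero_iff, lt_min_iff] at hlam
  have hroot : MvPolynomial.eval (point lam μ) p = 0 := by
    rw [← eval_slice]
    exact (Polynomial.mem_roots (slice_ne_zero hp hpd _)).1 hμ
  have hμ2 : ‖μ‖ < 1 / 2 := by
    by_contra! hge
    have hμ0 : μ ≠ 0 := norm_pos_iff.1 (by linarith)
    refine hball (μ⁻¹ • lam) ?_ ?_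
    · rw [mem_ball_zero_iff, norm_smul, norm_inv]
      have : ‖μ‖⁻¹ ≤ 2 := by
        rw [inv_le_comm₀ (by linarith) two_pos]
        linarith
      nlinarith [norm_nonneg lam]
    · have := eval_point_smul hp μ⁻¹ lam μ
      rwa [inv_mul_cancel₀ hμ0, hroot, mul_zero] at this
  rw [norm_point_lt_one_iff]
  nlinarith [norm_nonneg lam, norm_nonneg μ]

/-- The slice has degree `n`, hence `n` roots in all, so `n` roots in the ball are all of them. -/
theorem norm_lt_of_isBundleNhd {U : Set (EuclideanSpace ℂ (Fin m))} (hU : IsBundleNhd n p U)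
    {lam : EuclideanSpace ℂ (Fin m)} (hlam : lam ∈ U) {μ : ℂ} (hμ : μ ∈ (slice p lam).roots) :
    ‖point lam μ‖ < 1 := by
  classical
  have h := hU.roots_in_ball lam hlam
  rw [← natDegree_slice hp hpd lam,
    ← Polynomial.splits_iff_card_roots.1 (IsAlgClosed.splits (slice p lam)),
    Multiset.countP_eq_card] at h
  exact mem_ball_zero_iff.1 (h μ hμ)

theorem exists_isBundleNhd_ball : ∃ r : ℝ, 0 < r ∧
    IsBundleNhd n p (Metric.ball (0 : EuclideanSpace ℂ (Fin m)) r) := by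
  classical
  obtain ⟨r, hr, hr1, hroots⟩ := exists_radius_roots hp hpd
  refine ⟨r, hr, Metric.isOpen_ball, Metric.isConnected_ball hr,
    Metric.mem_ball_self hr, Metric.ball_subset_ball hr1, fun lam hlam => ?_, fun lam hlam => ?_⟩
  · rw [mem_ball_zero_iff] at hlam ⊢
    rw [EuclideanSpace.norm_eq] at hlam ⊢
    simpa [conjVec] using hlam
  · rw [← natDegree_slice hp hpd lam,
      ← Polynomial.splits_iff_card_roots.1 (IsAlgClosed.splits (slice p lam)),
      Multiset.countP_eq_card]
    exact fun μ hμ => mem_ball_zero_iff.2 (hroots lam hlam μ hμ)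

end Main

theorem conjVec_conjVec (lam : EuclideanSpace ℂ (Fin m)) : conjVec (conjVec lam) = lam := by
  ext i
  simp [conjVec]

/-! ### Membership in the Cowen-Douglas class -/

section CowenDouglas

variable {p : MvPolynomial (Fin (m + 1)) ℂ} (hp : p.IsHomogeneous n)
  (hpd : MvPolynomial.eval (Pi.single (Fin.last m) 1) p ≠ 0)
  {U : Set (EuclideanSpace ℂ (Fin m))} (hU : IsBundleNhd n p U)

include hp hpd hU

/-- The eigenspaces over a small ball about `0` inside `U` already have dense span; conjugation
invariance places their conjugated eigenvalues in `U`. -/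
theorem dense_span_jointKer :
    (⨆ ω ∈ U, jointKer (adjointTuple p) ω).topologicalClosure = ⊤ := by
  rw [Submodule.topologicalClosure_eq_top_iff, Submodule.eq_bot_iff]
  intro h hh
  rw [Submodule.mem_orthogonal] at hh
  obtain ⟨r, hr, hrU⟩ := Metric.isOpen_iff.1 hU.isOpen 0 hU.zero_mem
  refine Subtype.ext (eq_zero_of_orthogonal hp hpd hr (fun lam hlam μ hμ =>
    norm_lt_of_isBundleNhd hp hpd hU (hrU hlam) hμ) h.2 fun lam hlam k hk => ?_)
  rw [← map_jointKer_eq] at hk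
  obtain ⟨x, hx, rfl⟩ := hk
  exact hh x (Submodule.mem_iSup_of_mem _
    (Submodule.mem_iSup_of_mem (hU.conj_mem lam (hrU hlam)) hx))

theorem isCowenDouglas_adjointTuple : IsCowenDouglas n U (adjointTuple p) := by
  have hconj : ∀ ω ∈ U, ∃ lam ∈ U, ω = conjVec lam := fun ω hω =>
    ⟨conjVec ω, hU.conj_mem ω hω, (conjVec_conjVec ω).symm⟩
  have hequiv : ∀ lam, Nonempty (jointKer (adjointTuple p) (conjVec lam) ≃ₗ[ℂ]
      sliceSpace p lam) := fun lam => by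
    rw [← map_jointKer_eq]
    exact ⟨Submodule.equivMapOfInjective _ (Hp p).subtype_injective _⟩
  refine ⟨hU.isOpen, hU.isConnected, commute_adjointTuple p, ?_, ?_, ?_,
    dense_span_jointKer hp hpd hU⟩
  · rintro _ hω
    obtain ⟨lam, hlam, rfl⟩ := hconj _ hω
    exact isClosed_range_adjointTuple (slice_ne_zero hp hpd lam)
      fun μ hμ => norm_lt_of_isBundleNhd hp hpd hU hlam hμ
  · rintro _ hω
    obtain ⟨lam, hlam, rfl⟩ := hconj _ hω
    have := finiteDimensional_sliceSpace (slice_ne_zero hp hpd lam)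
      fun μ hμ => norm_lt_of_isBundleNhd hp hpd hU hlam hμ
    obtain ⟨e⟩ := hequiv lam
    exact e.symm.finiteDimensional
  · rintro _ hω
    obtain ⟨lam, hlam, rfl⟩ := hconj _ hω
    have hball : ∀ μ ∈ (slice p lam).roots, ‖point lam μ‖ < 1 :=
      fun μ hμ => norm_lt_of_isBundleNhd hp hpd hU hlam hμ
    obtain ⟨e⟩ := hequiv lam
    rw [e.finrank_eq]
    have h0 := slice_ne_zero hp hpd lam
    have h1 := finrank_sliceSpace_le h0 hball
    have h2 := le_finrank_sliceSpace h0 hball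
    rw [natDegree_slice hp hpd] at h1 h2
    exact le_antisymm h1 h2

end CowenDouglas

end DruryArveson

end

theorem theorem5p5 (m n : ℕ) (p : MvPolynomial (Fin (m + 1)) ℂ) (hp : p.IsHomogeneous n)
    (hpd : MvPolynomial.eval (Pi.single (Fin.last m) 1) p ≠ 0) :
    (∃ r : ℝ, 0 < r ∧
      DruryArveson.IsBundleNhd n p (Metric.ball (0 : EuclideanSpace ℂ (Fin m)) r)) ∧
    ∀ U : Set (EuclideanSpace ℂ (Fin m)), DruryArveson.IsBundleNhd n p U →
      IsCowenDouglas n U (DruryArveson.adjointTuple p) ∧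
      ∀ lam ∈ U,
        (jointKer (DruryArveson.adjointTuple p) (DruryArveson.conjVec lam)).map
            (DruryArveson.Hp p).subtype =
          Submodule.span ℂ {k : DruryArveson.H2 (m + 1) | ∃ (μ : ℂ) (l : ℕ),
            l < (DruryArveson.slice p lam).rootMultiplicity μ ∧
              DruryArveson.IsDerivKernel lam μ l k} := by
  refine ⟨DruryArveson.exists_isBundleNhd_ball hp hpd, fun U hU =>
    ⟨DruryArveson.isCowenDouglas_adjointTuple hp hpd hU, fun lam hlam => ?_⟩⟩
  rw [DruryArveson.map_jointKer_eq]
  exact DruryArveson.sliceSpace_eq_span (DruryArveson.slice_ne_zero hp hpd lam)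
    fun μ hμ => DruryArveson.norm_lt_of_isBundleNhd hp hpd hU hlam hμ
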